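/- Let $\mathcal L$ be a countable set of sites and let $E=\{1,\dots,q\}$. Let $J_{ij}=J_{ji}\in[-\infty,0]$ be antiferromagnetic couplings on the unordered pairs of distinct sites; $j$ is called a nearest neighbour of $i$ ($j\sim i$) if $j\neq i$ and $J_{ij}\neq 0$, and $d(i,j)\in\{0,1,2,\dots,\infty\}$ denotes the distance in the resulting nearest-neighbour graph. The $q$-state Potts model is defined, for finite $\Lambda\subset\mathcal L$, by $$H_\Lambda(\sigma)=-\sum_{\{i,j\}:\ i\sim j,\ \{i,j\}\cap\Lambda\neq\emptyset}J_{ij}\,\delta_{\sigma_i\sigma_j},\qquad \pi_\Lambda(\sigma_\Lambda\mid\sigma_{\Lambda^c})=\frac{e^{-H_\Lambda(\sigma)}}{\sum_{\tau\in E^\Lambda}e^{-H_\Lambda(\tau,\sigma_{\Lambda^c})}},$$ with $(-\infty)\cdot 0=0$ and $e^{-\infty}=0$ (zero temperature is the case where all nonzero $J_{ij}$ equal $-\infty$). An infinite-volume Gibbs measure is a probability measure $\mu$ on $E^{\mathcal L}$ whose conditional distribution of $\sigma_\Lambda$ given $\sigma_{\Lambda^c}$ is $\pi_\Lambda(\,\cdot\mid\sigma_{\Lambda^c})$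 for every finite $\Lambda$. For $j\ne i$ put $$c_{ij}=\sup_{\sigma,\tilde\sigma:\ \sigma_k=\tilde\sigma_k\ \forall k\neq j}\ \sup_{A\subset E}\bigl|\pi_{\{i\}}(A\mid\sigma)-\pi_{\{i\}}(A\mid\tilde\sigma)\bigr|,\qquad \alpha=\sup_{i}\sum_{j\neq i}c_{ij}.$$ Let $q,r$ be integers with $q>r\ge 0$. (1) If the site $i$ has at most $r$ nearest neighbours, then $c_{ij}\le \frac1{q-r}$ for all $j\neq i$, and $\sum_{j\neq i}c_{ij}\le\frac{r}{q-r}$. If every site has at most $r$ nearest neighbours, then $\alpha\le\frac{r}{q-r}$. (2) If $q>2r$, then there are constants $K<\infty$ and $m>0$ depending only on $q$ and $r$ such that for every $\mathcal L$ and all couplings $J_{ij}\in[-\infty,0]$ as above for which every site has at most $r$ nearest neighbours (hence uniformly in the temperature, including zero temperature): $\alpha<1$; there is exactly one infinite-volume Gibbs measure $\mu$; and its correlations decay exponentially, in the sense that for all measurable real functions $f,g$ on $E^{\mathcal L}$ of finite total oscillation the functions $f,g,fg$ are $\mu$-integrable and $$\bigl|\mu(fg)-\mu(f)\mu(g)\bigr|\le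 K\sum_{i,j\in\mathcal L}\delta_i(f)\,e^{-m\,d(i,j)}\,\delta_j(g)\qquad(e^{-\infty}=0),$$ where $\delta_i(f)=\sup\{|f(\sigma)-f(\sigma')|:\sigma_k=\sigma'_k\ \forall k\neq i\}$ and $f$ has finite total oscillation if $\sum_i\delta_i(f)<\infty$. -/

import Mathlib

open MeasureTheory ProbabilityTheory
open scoped ENNReal

namespace Potts

noncomputable section

variable {V : Type*} {q : ℕ}

/-- The nearest-neighbour graph of a family of pair couplings `J` with values in `[-∞, ∞]`:
`i ∼ j` iff `i ≠ j` and `J i j ≠ 0`. (Values of `J` on diagonal pairs are never used.) -/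
def nnGraph (J : Sym2 V → EReal) : SimpleGraph V where
  Adj i j := i ≠ j ∧ J s(i, j) ≠ 0
  symm := ⟨fun i j h => ⟨h.1.symm, by rw [Sym2.eq_swap]; exact h.2⟩⟩
  loopless := ⟨fun _ h => h.1 rfl⟩

open Classical in
/-- The Potts Hamiltonian of the volume `Λ`: the sum of `- J i j * δ (σ i) (σ j)` over all
nearest-neighbour pairs `{i, j}` (each counted once) that meet `Λ`. The Kronecker delta of the
pair `e = s(i, j)` is `1` iff `e.map σ = s(σ i, σ j)` is diagonal. -/
def hamiltonian (J : Sym2 V → EReal) (Λ : Finset V) (σ : V → Fin q) : EReal :=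
  ∑ᶠ e ∈ {e : Sym2 V | e ∈ (nnGraph J).edgeSet ∧ ∃ i ∈ Λ, i ∈ e},
    -(J e * (if (e.map σ).IsDiag then 1 else 0))

open Classical in
/-- The configuration equal to `τ` in `Λ` and to `σ` outside `Λ`. -/
def patch (Λ : Finset V) (τ : Λ → Fin q) (σ : V → Fin q) : V → Fin q :=
  fun k => if h : k ∈ Λ then τ ⟨k, h⟩ else σ k

/-- The Boltzmann factor `exp (-H_Λ)` of `τ` in `Λ` with external condition `σ`
(`EReal.exp` satisfies `exp (-∞) = 0`). -/
def weight (J : Sym2 V → EReal) (Λ : Finset V) (σ : V → Fin q) (τ : Λ → Fin q) : ℝ≥0∞ :=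
  EReal.exp (-(hamiltonian J Λ (patch Λ τ σ)))

open Classical in
/-- The partition function of `Λ` with external condition `σ`. -/
def partitionFunction (J : Sym2 V → EReal) (Λ : Finset V) (σ : V → Fin q) : ℝ≥0∞ :=
  ∑ τ : Λ → Fin q, weight J Λ σ τ

open Classical in
/-- The kernel `π_Λ(· | σ)` of the Potts specification: the Boltzmann-Gibbs distribution of the
spins in `Λ`, given the external condition `σ` (of which only the spins outside `Λ` matter). -/
def spec (J : Sym2 V → EReal) (Λ : Finset V) (σ : V → Fin q) : Measure (Λ → Fin q) :=
  ∑ τ : Λ → Fin q, (weight J Λ σ τ / partitionFunction J Λ σ) • Measure.dirac τ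

/-- The single-site kernel `π_{i}(· | σ)`, as a distribution of the spin at `i`. -/
def siteKernel (J : Sym2 V → EReal) (i : V) (σ : V → Fin q) : Measure (Fin q) :=
  (spec J {i} σ).map (fun τ => τ ⟨i, Finset.mem_singleton_self i⟩)

/-- The `σ`-algebra generated by the spins outside `Λ`. -/
@[reducible] def outside (q : ℕ) (Λ : Finset V) : MeasurableSpace (V → Fin q) :=
  MeasurableSpace.comap (Set.domRestrict (π := fun _ => Fin q) ((Λ : Set V)ᶜ)) inferInstance

/-- `μ` is an infinite-volume Gibbs measure: a probability measure whose conditional distribution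
of the spins in any finite `Λ`, given the spins outside `Λ`, is `π_Λ`. -/
structure IsGibbs (J : Sym2 V → EReal) (μ : Measure (V → Fin q)) : Prop where
  isProbabilityMeasure : IsProbabilityMeasure μ
  condProb_eq : ∀ (Λ : Finset V) (A : Set (Λ → Fin q)),
    μ⟦{σ | Λ.restrict σ ∈ A} | outside q Λ⟧ =ᵐ[μ] fun σ => (spec J Λ σ).real A

/-- The distance `sup_A |μ(A) - ν(A)|` (half of the variation distance). -/
def tvDist {E : Type*} [MeasurableSpace E] (μ ν : Measure E) : ℝ≥0∞ :=
  ⨆ (A : Set E) (_ : MeasurableSet A), ENNReal.ofReal |μ.real A - ν.real A|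

/-- The Dobrushin coefficient `c_ij` of the `q`-state Potts model (for `j ≠ i`). -/
def dobrushinCoeff (q : ℕ) (J : Sym2 V → EReal) (i j : V) : ℝ≥0∞ :=
  ⨆ (σ : V → Fin q) (σ' : V → Fin q) (_ : ∀ k, k ≠ j → σ k = σ' k),
    tvDist (siteKernel J i σ) (siteKernel J i σ')

/-- The Dobrushin constant `α = sup_i ∑_{j ≠ i} c_ij`. -/
def dobrushinConst (q : ℕ) (J : Sym2 V → EReal) : ℝ≥0∞ :=
  ⨆ i : V, ∑' j : {j : V // j ≠ i}, dobrushinCoeff q J i j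

/-- The oscillation of `f` at the site `i`. -/
def osc (f : (V → Fin q) → ℝ) (i : V) : ℝ≥0∞ :=
  ⨆ (σ : V → Fin q) (σ' : V → Fin q) (_ : ∀ k, k ≠ i → σ k = σ' k),
    ENNReal.ofReal |f σ - f σ'|

/-- The total oscillation of `f`. -/
def totalOsc (f : (V → Fin q) → ℝ) : ℝ≥0∞ := ∑' i : V, osc f i

open Classical in
/-- The factor `exp (-m d(i, j))`, where `d` is the graph distance in `G`
(`d = ∞` between different components). -/
def expDecay (G : SimpleGraph V) (m : ℝ) (i j : V) : ℝ≥0∞ :=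
  if G.Reachable i j then ENNReal.ofReal (Real.exp (-m * (G.dist i j : ℝ))) else 0

/-- Exponential decay of correlations with constant `K` and rate `m`: all observables `f`, `g` of
finite total oscillation have a covariance, and
`|μ(fg) - μ(f) μ(g)| ≤ K ∑_{i,j} δ_i(f) exp (-m d(i, j)) δ_j(g)`. -/
def HasExpDecay (G : SimpleGraph V) (K m : ℝ) (μ : Measure (V → Fin q)) : Prop :=
  ∀ f g : (V → Fin q) → ℝ, Measurable f → Measurable g → totalOsc f < ∞ → totalOsc g < ∞ →
    Integrable f μ ∧ Integrable g μ ∧ Integrable (fun σ => f σ * g σ) μ ∧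
    ENNReal.ofReal |∫ σ, f σ * g σ ∂μ - (∫ σ, f σ ∂μ) * ∫ σ, g σ ∂μ| ≤
      ENNReal.ofReal K * ∑' (i : V) (j : V), osc f i * expDecay G m i j * osc g j

end

end Potts

namespace Potts

noncomputable section

open scoped Classical

variable {V : Type*} {q : ℕ}

/-! Single-site estimate. Given its neighbours, the spin at `i` takes each colour with a weight in
`[0, 1]`, and a colour shown by no neighbour has weight 1; so the normalization is at least `q - r`.
Recolouring `j` can raise the weight of the old colour of `j`, lower that of the new one, and
changes no other. Comparing the two normalizations shows that, in one of the two directions, the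
normalized weights grow at a single colour at most, and there by at most `1 / (q - r)`. This bounds
each `c_ij` (`abs_sum_sub_le`, `dobrushinCoeff_le`); at most `r` sites `j` contribute, so the row
sums are at most `r / (q - r)`, which is below 1 when `q > 2 * r`.

Uniqueness and decay. Averaging `f` over the spin at `i` removes the oscillation of `f` at `i` and
adds at most `c_ij δ_i(f)` at each other `j` (`osc_avg_le`), without changing the integral against a
Gibbs measure. A weight `φ` with `w i + ∑ c_ij φ_j ≤ φ_i` makes `∑ δ_j φ_j` drop by at least `δ_i
w_i` in such a step (`tsum_step_add_le`). With `φ = 1` and constant `w`, finitely many steps make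
the total oscillation arbitrarily small, so Gibbs measures agree on cylinder events
(`invariant_unique`). For covariances, one step costs at most `δ_i(f) δ_i(g)`; with `w = δ(g)` and
`φ` the exponentially weighted sum of `δ(g)`, the total cost is the asserted bound
(`decay_supersolution`, `cov_le_cost_add`).

Discontinuous observables. Finite total oscillation controls `f` only under finite modifications of
a configuration. The covariance bound for continuous `f` yields a zero-one law for events invariant
under such modifications (`Invariant.measure_eq_zero_or_one`); hence any `f` of finite total
oscillation is almost surely within it of a constant, and the argument extends.

Existence. Greedy colouring keeps partition functions positive even at zero temperature, so the
kernels are continuous; a limit of finite-volume distributions in the compact space of probability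
measures is then Gibbs (`exists_isGibbs`). -/

/-- The nearest-neighbour pairs that meet `Λ`. -/
def touching (J : Sym2 V → EReal) (Λ : Finset V) : Set (Sym2 V) :=
  {e : Sym2 V | e ∈ (nnGraph J).edgeSet ∧ ∃ i ∈ Λ, i ∈ e}

/-- The Boltzmann factor of a single pair. -/
def bond (J : Sym2 V → EReal) (σ : V → Fin q) (e : Sym2 V) : ℝ :=
  if (e.map σ).IsDiag then (EReal.exp (J e)).toReal else 1

/-- The Boltzmann factor of a configuration in the volume `Λ`, as a real number. -/
def boltzmann (J : Sym2 V → EReal) (Λ : Finset V) (σ : V → Fin q) : ℝ :=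
  (EReal.exp (-(hamiltonian J Λ σ))).toReal

/-- The probability of `τ` in `Λ` given the external condition `σ`, as a real number. -/
def prob (J : Sym2 V → EReal) (Λ : Finset V) (σ : V → Fin q) (τ : Λ → Fin q) : ℝ :=
  boltzmann J Λ (patch Λ τ σ) / ∑ η : Λ → Fin q, boltzmann J Λ (patch Λ η σ)

/-- The expectation of `f` under the kernel of `Λ`, as a function of the external condition. -/
def avg (J : Sym2 V → EReal) (Λ : Finset V) (f : (V → Fin q) → ℝ) (σ : V → Fin q) : ℝ :=
  ∑ τ : Λ → Fin q, prob J Λ σ τ * f (patch Λ τ σ)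

/-! ### Gluing configurations -/

section Patch

lemma patch_of_mem {Λ : Finset V} (τ : Λ → Fin q) (σ : V → Fin q) {k : V} (h : k ∈ Λ) :
    patch Λ τ σ k = τ ⟨k, h⟩ := by simp [patch, h]

lemma patch_of_notMem {Λ : Finset V} (τ : Λ → Fin q) (σ : V → Fin q) {k : V} (h : k ∉ Λ) :
    patch Λ τ σ k = σ k := by simp [patch, h]

lemma patch_congr {Λ : Finset V} (τ : Λ → Fin q) {σ σ' : V → Fin q}
    (h : ∀ k, k ∉ Λ → σ k = σ' k) : patch Λ τ σ = patch Λ τ σ' := by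
  funext k
  by_cases hk : k ∈ Λ
  · rw [patch_of_mem _ _ hk, patch_of_mem _ _ hk]
  · rw [patch_of_notMem _ _ hk, patch_of_notMem _ _ hk, h k hk]

lemma patch_patch {Λ : Finset V} (τ τ' : Λ → Fin q) (σ : V → Fin q) :
    patch Λ τ (patch Λ τ' σ) = patch Λ τ σ :=
  patch_congr τ fun _ hk => patch_of_notMem _ _ hk

lemma patch_restrict (Λ : Finset V) (σ : V → Fin q) : patch Λ (Λ.restrict σ) σ = σ := by
  funext k
  by_cases hk : k ∈ Λ
  · rw [patch_of_mem _ _ hk]; rfl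
  · rw [patch_of_notMem _ _ hk]

lemma restrict_patch (Λ : Finset V) (τ : Λ → Fin q) (σ : V → Fin q) :
    Λ.restrict (patch Λ τ σ) = τ := by
  funext k
  exact patch_of_mem _ _ k.2

lemma patch_restrict_of_eq {Λ : Finset V} {σ σ' : V → Fin q}
    (h : ∀ k, k ∉ Λ → σ k = σ' k) : patch Λ (Λ.restrict σ) σ' = σ := by
  rw [← patch_congr _ h, patch_restrict]

lemma patch_comm_single {i j : V} (τ : ({i} : Finset V) → Fin q)
    {σ σ' : V → Fin q} (h : ∀ k, k ≠ j → σ k = σ' k) :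
    ∀ k, k ≠ j → patch {i} τ σ k = patch {i} τ σ' k := by
  intro k hk
  by_cases hki : k ∈ ({i} : Finset V)
  · rw [patch_of_mem _ _ hki, patch_of_mem _ _ hki]
  · rw [patch_of_notMem _ _ hki, patch_of_notMem _ _ hki, h k hk]

end Patch

/-! ### Boltzmann factors as real products over bonds -/

section Weights

variable {J : Sym2 V → EReal}

lemma touching_finite {Λ : Finset V}
    (h : ∀ i ∈ Λ, ((nnGraph J).neighborSet i).Finite) : (touching J Λ).Finite := by
  refine (Λ.finite_toSet.biUnion fun i hi => ((h i hi).image fun k => s(i, k))).subset ?_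
  rintro e ⟨he, i, hi, hie⟩
  obtain ⟨k, rfl⟩ := Sym2.mem_iff_exists.1 hie
  exact Set.mem_biUnion hi ⟨k, he, rfl⟩

lemma bond_nonneg (σ : V → Fin q) (e : Sym2 V) : 0 ≤ bond J σ e := by
  unfold bond; split_ifs <;> simp

lemma toReal_exp_le_one {x : EReal} (h : x ≤ 0) : (EReal.exp x).toReal ≤ 1 :=
  ENNReal.toReal_le_of_le_ofReal zero_le_one (by simpa using h)

lemma bond_le_one (hJ : ∀ e, J e ≤ 0) (σ : V → Fin q) (e : Sym2 V) : bond J σ e ≤ 1 := by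
  unfold bond
  split_ifs
  · exact toReal_exp_le_one (hJ e)
  · exact le_rfl

lemma bond_congr {σ σ' : V → Fin q} {e : Sym2 V} (h : ∀ k ∈ e, σ k = σ' k) :
    bond J σ e = bond J σ' e := by
  unfold bond
  rw [Sym2.map_congr h]

/-- Negation distributes over a sum in `EReal` only away from `∞ - ∞`; nonnegativity of the partial
sums rules this out, so both claims are carried through one induction. -/
lemma exp_neg_sum {ι : Type*} (s : Finset ι) (x : ι → EReal) (hx : ∀ i, x i ≤ 0) :
    0 ≤ ∑ i ∈ s, -x i ∧
      EReal.exp (-(∑ i ∈ s, -x i)) = ∏ i ∈ s, EReal.exp (x i) := by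
  induction s using Finset.induction_on with
  | empty => simp
  | insert a s ha ih =>
    have h1 : 0 ≤ -x a := by simpa using hx a
    rw [Finset.sum_insert ha, Finset.prod_insert ha]
    refine ⟨add_nonneg h1 ih.1, ?_⟩
    rw [EReal.neg_add (Or.inl (ne_of_gt (lt_of_lt_of_le EReal.bot_lt_zero h1)))
      (Or.inr (ne_of_gt (lt_of_lt_of_le EReal.bot_lt_zero ih.1))), sub_eq_add_neg,
      EReal.exp_add, ih.2, neg_neg]

lemma boltzmann_eq_prod (hJ : ∀ e, J e ≤ 0) {Λ : Finset V} (h : (touching J Λ).Finite)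
    (σ : V → Fin q) : boltzmann J Λ σ = ∏ e ∈ h.toFinset, bond J σ e := by
  have h1 : hamiltonian J Λ σ =
      ∑ e ∈ h.toFinset, -(J e * (if (e.map σ).IsDiag then 1 else 0)) := by
    rw [hamiltonian]
    exact finsum_mem_eq_finite_toFinset_sum _ h
  rw [boltzmann, h1, (exp_neg_sum _ _ fun e => ?_).2, ENNReal.toReal_prod]
  · refine Finset.prod_congr rfl fun e _ => ?_
    unfold bond
    split_ifs <;> simp
  · split_ifs
    · simpa using hJ e
    · simp

lemma boltzmann_nonneg (Λ : Finset V) (σ : V → Fin q) : 0 ≤ boltzmann J Λ σ :=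
  ENNReal.toReal_nonneg

lemma exp_hamiltonian_ne_top (hJ : ∀ e, J e ≤ 0) {Λ : Finset V} (h : (touching J Λ).Finite)
    (σ : V → Fin q) : EReal.exp (-(hamiltonian J Λ σ)) ≠ ∞ := by
  have h1 : hamiltonian J Λ σ =
      ∑ e ∈ h.toFinset, -(J e * (if (e.map σ).IsDiag then 1 else 0)) := by
    rw [hamiltonian]
    exact finsum_mem_eq_finite_toFinset_sum _ h
  have h2 : 0 ≤ hamiltonian J Λ σ := by
    rw [h1]
    refine (exp_neg_sum _ _ fun e => ?_).1
    split_ifs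
    · simpa using hJ e
    · simp
  intro h3
  rw [EReal.exp_eq_top_iff, EReal.neg_eq_top_iff] at h3
  rw [h3] at h2
  simp at h2

lemma prob_eq (hJ : ∀ e, J e ≤ 0) {Λ : Finset V} (h : (touching J Λ).Finite)
    (σ : V → Fin q) (τ : Λ → Fin q) :
    (weight J Λ σ τ / partitionFunction J Λ σ).toReal = prob J Λ σ τ := by
  rw [ENNReal.toReal_div, partitionFunction, ENNReal.toReal_sum]
  · rfl
  · exact fun η _ => exp_hamiltonian_ne_top hJ h _

lemma prob_nonneg (Λ : Finset V) (σ : V → Fin q) (τ : Λ → Fin q) : 0 ≤ prob J Λ σ τ :=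
  div_nonneg (boltzmann_nonneg _ _) (Finset.sum_nonneg fun _ _ => boltzmann_nonneg _ _)

/-- The partition function of `Λ` does not vanish for any external condition. -/
def Admissible (q : ℕ) (J : Sym2 V → EReal) (Λ : Finset V) : Prop :=
  ∀ σ : V → Fin q, 0 < ∑ η : Λ → Fin q, boltzmann J Λ (patch Λ η σ)

lemma sum_prob {Λ : Finset V} (h : Admissible q J Λ) (σ : V → Fin q) :
    ∑ τ : Λ → Fin q, prob J Λ σ τ = 1 := by
  unfold prob
  rw [← Finset.sum_div, div_self (h σ).ne']

lemma prob_congr {Λ : Finset V} {σ σ' : V → Fin q} (h : ∀ k, k ∉ Λ → σ k = σ' k)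
    (τ : Λ → Fin q) : prob J Λ σ τ = prob J Λ σ' τ := by
  have : ∀ η : Λ → Fin q, patch Λ η σ = patch Λ η σ' := fun η => patch_congr η h
  simp only [prob, this]

lemma weight_div_ne_top (hJ : ∀ e, J e ≤ 0) {Λ : Finset V} (h : (touching J Λ).Finite)
    (ha : Admissible q J Λ) (σ : V → Fin q) (τ : Λ → Fin q) :
    weight J Λ σ τ / partitionFunction J Λ σ ≠ ∞ := by
  refine ENNReal.div_ne_top (exp_hamiltonian_ne_top hJ h _) fun h0 => ?_
  have := ha σ
  have h2 : (partitionFunction J Λ σ).toReal = ∑ η : Λ → Fin q, boltzmann J Λ (patch Λ η σ) := by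
    rw [partitionFunction, ENNReal.toReal_sum]
    · rfl
    · exact fun η _ => exp_hamiltonian_ne_top hJ h _
  rw [← h2, h0] at this
  simp at this

lemma spec_real (hJ : ∀ e, J e ≤ 0) {Λ : Finset V} (h : (touching J Λ).Finite)
    (ha : Admissible q J Λ) (σ : V → Fin q) (A : Set (Λ → Fin q)) :
    (spec J Λ σ).real A = ∑ τ : Λ → Fin q, prob J Λ σ τ * A.indicator 1 τ := by
  have hA : MeasurableSet A := A.toFinite.measurableSet
  rw [Measure.real, spec, Measure.finsetSum_apply, ENNReal.toReal_sum]
  · refine Finset.sum_congr rfl fun τ _ => ?_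
    rw [Measure.smul_apply, smul_eq_mul, ENNReal.toReal_mul, prob_eq hJ h,
      Measure.dirac_apply' _ hA]
    by_cases hτ : τ ∈ A <;> simp [hτ]
  · intro τ _
    rw [Measure.smul_apply, smul_eq_mul]
    refine ENNReal.mul_ne_top (weight_div_ne_top hJ h ha σ τ) ?_
    exact measure_ne_top _ _

end Weights

/-! ### Comparison of two normalized weights -/

section Comparison

variable {ι : Type*} [Fintype ι]

/-- Away from `b` the first weight is smaller and its normalization larger, so only `b` can
contribute positively to the difference, and it contributes at most `D / n`. -/
lemma abs_sum_sub_le_of_sum_le {w w' : ι → ℝ} {b : ι} {n D : ℝ} {F : ι → ℝ} (hn : 0 < n)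
    (hw' : ∀ s, 0 ≤ w' s) (hb : w b ≤ 1)
    (hZ : n ≤ ∑ s, w s) (hZ' : n ≤ ∑ s, w' s)
    (h : ∀ s, s ≠ b → w s ≤ w' s) (hF : ∀ s, 0 ≤ F s) (hFD : ∀ s, F s ≤ D)
    (hle : ∑ s, w' s ≤ ∑ s, w s) :
    |∑ s, (w s / ∑ s, w s) * F s - ∑ s, (w' s / ∑ s, w' s) * F s| ≤ D / n := by
  set Z := ∑ s, w s with hZdef
  set Z' := ∑ s, w' s with hZdef'
  have hZ0 : 0 < Z := hn.trans_le hZ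
  have hZ0' : 0 < Z' := hn.trans_le hZ'
  have key : ∀ G : ι → ℝ, (∀ s, 0 ≤ G s) → (∀ s, G s ≤ D) →
      ∑ s, (w s / Z - w' s / Z') * G s ≤ D / n := by
    intro G hG hGD
    rw [← Finset.add_sum_erase _ _ (Finset.mem_univ b)]
    have h1 : (w b / Z - w' b / Z') * G b ≤ D / n := by
      calc (w b / Z - w' b / Z') * G b ≤ w b / Z * G b := by
            gcongr
            · exact hG b
            · linarith [div_nonneg (hw' b) hZ0'.le]
        _ ≤ (1 / n) * D := by
            gcongr
            · exact hG b
            · exact hGD b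
        _ = D / n := by ring
    have h2 : ∑ s ∈ Finset.univ.erase b, (w s / Z - w' s / Z') * G s ≤ 0 := by
      refine Finset.sum_nonpos fun s hs => mul_nonpos_of_nonpos_of_nonneg ?_ (hG s)
      have : w s / Z ≤ w' s / Z' :=
        div_le_div₀ (hw' s) (h s (Finset.ne_of_mem_erase hs)) hZ0' hle
      linarith
    linarith
  have e1 : ∑ s, w s / Z * F s - ∑ s, w' s / Z' * F s = ∑ s, (w s / Z - w' s / Z') * F s := by
    rw [← Finset.sum_sub_distrib]
    exact Finset.sum_congr rfl fun s _ => by ring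
  -- Both normalized weights have mass 1, so replacing `F` by `D - F` flips the sign and turns the
  -- one-sided bound `key` into a two-sided one.
  have e2 : ∑ s, (w s / Z - w' s / Z') * (D - F s) = -∑ s, (w s / Z - w' s / Z') * F s := by
    have : ∑ s, (w s / Z - w' s / Z') = 0 := by
      rw [Finset.sum_sub_distrib, ← Finset.sum_div, ← Finset.sum_div, div_self hZ0.ne',
        div_self hZ0'.ne', sub_self]
    simp only [mul_sub, Finset.sum_sub_distrib, ← Finset.sum_mul, this]
    ring
  rw [e1, abs_le]
  have k1 := key F hF hFD
  have k2 := key (fun s => D - F s) (fun s => by linarith [hFD s]) (fun s => by linarith [hF s])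
  rw [e2] at k2
  exact ⟨by linarith, k1⟩

/-- Two normalized weights that differ in opposite directions at two points only assign
expectations to a function with values in `[0, D]` that differ by at most `D / n`,
if their total masses are at least `n`. -/
lemma abs_sum_sub_le {w w' : ι → ℝ} {a b : ι} {n D : ℝ} {F : ι → ℝ} (hn : 0 < n)
    (hw : ∀ s, 0 ≤ w s) (hw' : ∀ s, 0 ≤ w' s) (hb : w b ≤ 1) (ha : w' a ≤ 1)
    (hZ : n ≤ ∑ s, w s) (hZ' : n ≤ ∑ s, w' s)
    (h : ∀ s, s ≠ b → w s ≤ w' s) (h' : ∀ s, s ≠ a → w' s ≤ w s)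
    (hF : ∀ s, 0 ≤ F s) (hFD : ∀ s, F s ≤ D) :
    |∑ s, (w s / ∑ s, w s) * F s - ∑ s, (w' s / ∑ s, w' s) * F s| ≤ D / n := by
  rcases le_total (∑ s, w' s) (∑ s, w s) with hle | hle
  · exact abs_sum_sub_le_of_sum_le hn hw' hb hZ hZ' h hF hFD hle
  · rw [abs_sub_comm]
    exact abs_sum_sub_le_of_sum_le hn hw ha hZ' hZ h' hF hFD hle

end Comparison

/-! ### The single-site kernel and the Dobrushin coefficients -/

section SingleSite

variable {J : Sym2 V → EReal}

lemma boltzmann_singleton (hJ : ∀ e, J e ≤ 0) {i : V} (h : ((nnGraph J).neighborSet i).Finite)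
    (σ : V → Fin q) :
    boltzmann J {i} σ =
      ∏ k ∈ h.toFinset, if σ i = σ k then (EReal.exp (J s(i, k))).toReal else 1 := by
  have hfin : (touching J {i}).Finite := touching_finite (by simpa using h)
  rw [boltzmann_eq_prod hJ hfin]
  have himg : hfin.toFinset = h.toFinset.image fun k => s(i, k) := by
    ext e
    simp only [Set.Finite.mem_toFinset, Finset.mem_image, touching, Finset.mem_singleton,
      exists_eq_left, Set.mem_ofPred_eq]
    constructor
    · rintro ⟨he, hie⟩
      obtain ⟨k, rfl⟩ := Sym2.mem_iff_exists.1 hie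
      exact ⟨k, he, rfl⟩
    · rintro ⟨k, hk, rfl⟩
      exact ⟨hk, Sym2.mem_mk_left i k⟩
  rw [himg, Finset.prod_image]
  · simp [bond]
  · intro a _ b _ hab
    exact Sym2.congr_right.1 hab

/-- The weights `τ ↦ exp (-H_{i} (τ, σ))` of the spin at `i`. -/
lemma boltzmann_singleton_patch (hJ : ∀ e, J e ≤ 0) {i : V}
    (h : ((nnGraph J).neighborSet i).Finite) (σ : V → Fin q) (τ : ({i} : Finset V) → Fin q) :
    boltzmann J {i} (patch {i} τ σ) =
      ∏ k ∈ h.toFinset, if τ ⟨i, Finset.mem_singleton_self i⟩ = σ k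
        then (EReal.exp (J s(i, k))).toReal else 1 := by
  rw [boltzmann_singleton hJ h]
  refine Finset.prod_congr rfl fun k hk => ?_
  have hki : k ∉ ({i} : Finset V) := by
    rw [Set.Finite.mem_toFinset] at hk
    rw [Finset.mem_singleton]
    exact ((nnGraph J).ne_of_adj hk).symm
  rw [patch_of_mem _ _ (Finset.mem_singleton_self i), patch_of_notMem _ _ hki]

lemma boltzmann_le_one (hJ : ∀ e, J e ≤ 0) {Λ : Finset V} (h : (touching J Λ).Finite)
    (σ : V → Fin q) : boltzmann J Λ σ ≤ 1 := by
  rw [boltzmann_eq_prod hJ h]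
  exact Finset.prod_le_one (fun _ _ => bond_nonneg _ _) fun _ _ => bond_le_one hJ _ _

/-- The neighbours of `i` show at most `r` colours, and each of the remaining colours has weight
exactly 1, whatever the temperature. -/
lemma card_sub_le_sum_boltzmann (hJ : ∀ e, J e ≤ 0) {i : V} {r : ℕ}
    (h : ((nnGraph J).neighborSet i).encard ≤ r) (σ : V → Fin q) :
    (q : ℝ) - r ≤ ∑ η : ({i} : Finset V) → Fin q, boltzmann J {i} (patch {i} η σ) := by
  have hfin : ((nnGraph J).neighborSet i).Finite := Set.finite_of_encard_le_coe h
  have hcard : hfin.toFinset.card ≤ r := by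
    rw [hfin.encard_eq_coe_toFinset_card] at h
    exact_mod_cast h
  rw [← (Equiv.funUnique ({i} : Finset V) (Fin q)).symm.sum_comp]
  have h1 : ∀ s : Fin q, (if s ∈ hfin.toFinset.image σ then (0 : ℝ) else 1) ≤
      boltzmann J {i} (patch {i} ((Equiv.funUnique ({i} : Finset V) (Fin q)).symm s) σ) := by
    intro s
    split_ifs with hs
    · exact boltzmann_nonneg _ _
    · rw [boltzmann_singleton_patch hJ hfin]
      refine le_of_eq (Finset.prod_eq_one fun k hk => if_neg fun hsk => hs ?_).symm
      exact Finset.mem_image.2 ⟨k, hk, hsk.symm⟩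
  refine le_trans ?_ (Finset.sum_le_sum fun s _ => h1 s)
  have h2 : ∑ s : Fin q, (if s ∈ hfin.toFinset.image σ then (0 : ℝ) else 1) =
      (q : ℝ) - (hfin.toFinset.image σ).card := by
    have : ∀ s : Fin q, (if s ∈ hfin.toFinset.image σ then (0 : ℝ) else 1) =
        1 - (if s ∈ hfin.toFinset.image σ then (1 : ℝ) else 0) := by
      intro s; split_ifs <;> simp
    simp [this, Finset.sum_sub_distrib, -Finset.mem_image]
  rw [h2]
  have h3 : ((hfin.toFinset.image σ).card : ℝ) ≤ r := by
    exact_mod_cast Finset.card_image_le.trans hcard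
  linarith

lemma admissible_singleton (hJ : ∀ e, J e ≤ 0) {i : V} {r : ℕ} (hqr : r < q)
    (h : ((nnGraph J).neighborSet i).encard ≤ r) : Admissible q J {i} := fun σ => by
  have h1 : (r : ℝ) < q := by exact_mod_cast hqr
  exact lt_of_lt_of_le (by linarith) (card_sub_le_sum_boltzmann hJ h σ)

/-- Unless the spin at `i` has the colour of `j` in `σ'`, the bond to `j` has factor 1 there, the
largest possible; the other bonds do not notice the change. -/
lemma boltzmann_patch_le (hJ : ∀ e, J e ≤ 0) {i j : V}
    (h : ((nnGraph J).neighborSet i).Finite) {σ σ' : V → Fin q} (hσ : ∀ k, k ≠ j → σ k = σ' k)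
    (τ : ({i} : Finset V) → Fin q) (hτ : τ ≠ fun _ => σ' j) :
    boltzmann J {i} (patch {i} τ σ) ≤ boltzmann J {i} (patch {i} τ σ') := by
  rw [boltzmann_singleton_patch hJ h, boltzmann_singleton_patch hJ h]
  refine Finset.prod_le_prod (fun k _ => by split_ifs <;> simp) fun k _ => ?_
  by_cases hk : k = j
  · subst hk
    have : τ ⟨i, Finset.mem_singleton_self i⟩ ≠ σ' k := by
      intro h0
      refine hτ (funext fun x => ?_)
      rw [← h0]
      congr 1
      exact Subsingleton.elim _ _
    rw [if_neg this]
    split_ifs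
    · exact toReal_exp_le_one (hJ _)
    · exact le_rfl
  · rw [hσ k hk]

/-- The single-site expectation of a function with values in `[0, D]` changes by at most
`D / (q - r)` when the external condition is changed at one site. -/
lemma abs_sum_prob_sub_le (hJ : ∀ e, J e ≤ 0) {i j : V} {r : ℕ} (hqr : r < q)
    (h : ((nnGraph J).neighborSet i).encard ≤ r) {σ σ' : V → Fin q}
    (hσ : ∀ k, k ≠ j → σ k = σ' k) {F : (({i} : Finset V) → Fin q) → ℝ} {D : ℝ}
    (hF : ∀ s, 0 ≤ F s) (hFD : ∀ s, F s ≤ D) :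
    |∑ τ, prob J {i} σ τ * F τ - ∑ τ, prob J {i} σ' τ * F τ| ≤ D / ((q : ℝ) - r) := by
  have hfin : ((nnGraph J).neighborSet i).Finite := Set.finite_of_encard_le_coe h
  have hfin' : (touching J {i}).Finite := touching_finite (by simpa using hfin)
  have h1 : (r : ℝ) < q := by exact_mod_cast hqr
  exact abs_sum_sub_le (a := fun _ => σ j) (b := fun _ => σ' j) (by linarith)
    (fun _ => boltzmann_nonneg _ _) (fun _ => boltzmann_nonneg _ _)
    (boltzmann_le_one hJ hfin' _) (boltzmann_le_one hJ hfin' _)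
    (card_sub_le_sum_boltzmann hJ h σ) (card_sub_le_sum_boltzmann hJ h σ')
    (boltzmann_patch_le hJ hfin hσ)
    (boltzmann_patch_le hJ hfin fun k hk => (hσ k hk).symm) hF hFD

lemma prob_singleton_congr (hJ : ∀ e, J e ≤ 0) {i : V}
    (h : ((nnGraph J).neighborSet i).Finite) {σ σ' : V → Fin q}
    (hσ : ∀ k, (nnGraph J).Adj i k → σ k = σ' k) (τ : ({i} : Finset V) → Fin q) :
    prob J {i} σ τ = prob J {i} σ' τ := by
  have : ∀ η : ({i} : Finset V) → Fin q,
      boltzmann J {i} (patch {i} η σ) = boltzmann J {i} (patch {i} η σ') := by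
    intro η
    rw [boltzmann_singleton_patch hJ h, boltzmann_singleton_patch hJ h]
    refine Finset.prod_congr rfl fun k hk => ?_
    rw [hσ k (by simpa using hk)]
  simp only [prob, this]

lemma siteKernel_real (hJ : ∀ e, J e ≤ 0) {i : V} {r : ℕ} (hqr : r < q)
    (h : ((nnGraph J).neighborSet i).encard ≤ r) (σ : V → Fin q) (A : Set (Fin q)) :
    (siteKernel J i σ).real A = ∑ τ : ({i} : Finset V) → Fin q, prob J {i} σ τ *
      A.indicator 1 (τ ⟨i, Finset.mem_singleton_self i⟩) := by
  have hfin : ((nnGraph J).neighborSet i).Finite := Set.finite_of_encard_le_coe h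
  rw [siteKernel, Measure.real, Measure.map_apply (measurable_pi_apply (⟨i, Finset.mem_singleton_self i⟩ : ({i} : Finset V)))
    A.toFinite.measurableSet, ← Measure.real, spec_real hJ (touching_finite (by simpa using hfin))
    (admissible_singleton hJ hqr h)]
  rfl

theorem dobrushinCoeff_le (hJ : ∀ e, J e ≤ 0) {i : V} {r : ℕ} (hqr : r < q)
    (h : ((nnGraph J).neighborSet i).encard ≤ r) (j : V) :
    dobrushinCoeff q J i j ≤ ENNReal.ofReal (1 / ((q : ℝ) - r)) := by
  refine iSup_le fun σ => iSup_le fun σ' => iSup_le fun hσ => iSup_le fun A => iSup_le fun _ => ?_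
  rw [siteKernel_real hJ hqr h, siteKernel_real hJ hqr h]
  refine ENNReal.ofReal_le_ofReal (abs_sum_prob_sub_le hJ hqr h hσ (fun τ => ?_) fun τ => ?_)
  · exact Set.indicator_nonneg (fun _ _ => zero_le_one) _
  · exact Set.indicator_le' (fun _ _ => le_rfl) (fun _ _ => zero_le_one) _

lemma dobrushinCoeff_eq_zero (hJ : ∀ e, J e ≤ 0) {i : V} {r : ℕ} (hqr : r < q)
    (h : ((nnGraph J).neighborSet i).encard ≤ r) {j : V} (hij : ¬ (nnGraph J).Adj i j) :
    dobrushinCoeff q J i j = 0 := by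
  refine le_antisymm (iSup_le fun σ => iSup_le fun σ' => iSup_le fun hσ => iSup_le fun A =>
    iSup_le fun _ => ?_) zero_le
  have : ∀ τ, prob J {i} σ τ = prob J {i} σ' τ :=
    prob_singleton_congr hJ (Set.finite_of_encard_le_coe h) fun k hk =>
      hσ k fun hkj => hij (hkj ▸ hk)
  rw [siteKernel_real hJ hqr h, siteKernel_real hJ hqr h]
  simp [this]

lemma tsum_neighbor_le {G : SimpleGraph V} {i : V} {r : ℕ} (h : (G.neighborSet i).encard ≤ r)
    (t : ℝ≥0∞) : ∑' j, (if G.Adj i j then t else 0) ≤ r * t := by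
  have hfin : (G.neighborSet i).Finite := Set.finite_of_encard_le_coe h
  have hcard : hfin.toFinset.card ≤ r := by
    rw [hfin.encard_eq_coe_toFinset_card] at h
    exact_mod_cast h
  rw [tsum_eq_sum (s := hfin.toFinset) fun j hj => if_neg (by simpa using hj)]
  refine (Finset.sum_le_card_nsmul _ _ t fun j _ => ?_).trans ?_
  · split_ifs <;> simp
  · rw [nsmul_eq_mul]
    gcongr

theorem tsum_dobrushinCoeff_le (hJ : ∀ e, J e ≤ 0) {i : V} {r : ℕ} (hqr : r < q)
    (h : ((nnGraph J).neighborSet i).encard ≤ r) :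
    ∑' j : {j : V // j ≠ i}, dobrushinCoeff q J i j ≤ ENNReal.ofReal ((r : ℝ) / ((q : ℝ) - r)) := by
  have h1 : ∀ j, dobrushinCoeff q J i j ≤
      if (nnGraph J).Adj i j then ENNReal.ofReal (1 / ((q : ℝ) - r)) else 0 := by
    intro j
    split_ifs with hj
    · exact dobrushinCoeff_le hJ hqr h j
    · exact (dobrushinCoeff_eq_zero hJ hqr h hj).le
  calc ∑' j : {j : V // j ≠ i}, dobrushinCoeff q J i j
      ≤ ∑' j, dobrushinCoeff q J i j :=
        ENNReal.tsum_comp_le_tsum_of_injective Subtype.val_injective _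
    _ ≤ _ := ENNReal.tsum_le_tsum h1
    _ ≤ _ := tsum_neighbor_le h _
    _ = _ := by
      rw [← ENNReal.ofReal_natCast, ← ENNReal.ofReal_mul (Nat.cast_nonneg r)]
      congr 1
      ring

end SingleSite

/-! ### Positivity of partition functions by greedy colouring -/

section Admissible

variable {J : Sym2 V → EReal}

/-- Greedy colouring of a finite volume. -/
lemma exists_properColoring {r : ℕ} (hqr : r < q)
    (h : ∀ i : V, ((nnGraph J).neighborSet i).encard ≤ r) (Λ : Finset V) (σ : V → Fin q) :
    ∃ σ' : V → Fin q, (∀ k, k ∉ Λ → σ' k = σ k) ∧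
      ∀ i ∈ Λ, ∀ j, (nnGraph J).Adj i j → σ' i ≠ σ' j := by
  induction Λ using Finset.induction_on with
  | empty => exact ⟨σ, fun _ _ => rfl, by simp⟩
  | insert i Λ hi ih =>
    obtain ⟨η, hη, hη'⟩ := ih
    have hfin : ((nnGraph J).neighborSet i).Finite := Set.finite_of_encard_le_coe (h i)
    have hcard : hfin.toFinset.card ≤ r := by
      have := h i
      rw [hfin.encard_eq_coe_toFinset_card] at this
      exact_mod_cast this
    obtain ⟨c, hc⟩ : ∃ c, c ∉ hfin.toFinset.image η := by
      by_contra! hall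
      have h1 : (Finset.univ : Finset (Fin q)).card ≤ (hfin.toFinset.image η).card :=
        Finset.card_le_card fun c _ => hall c
      have h2 := Finset.card_image_le (s := hfin.toFinset) (f := η)
      rw [Finset.card_univ, Fintype.card_fin] at h1
      omega
    have hc' : ∀ k, (nnGraph J).Adj i k → η k ≠ c := fun k hk hkc =>
      hc (Finset.mem_image.2 ⟨k, by simpa using hk, hkc⟩)
    refine ⟨Function.update η i c, fun k hk => ?_, fun k hk j hkj => ?_⟩
    · rw [Finset.mem_insert, not_or] at hk
      rw [Function.update_of_ne hk.1, hη k hk.2]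
    · by_cases hki : k = i
      · subst hki
        rw [Function.update_self, Function.update_of_ne hkj.ne']
        exact (hc' j hkj).symm
      · rw [Function.update_of_ne hki]
        by_cases hji : j = i
        · subst hji
          rw [Function.update_self]
          exact hc' k hkj.symm
        · rw [Function.update_of_ne hji]
          exact hη' k (Finset.mem_of_mem_insert_of_ne hk hki) j hkj

lemma touching_finite_of_encard_le {r : ℕ}
    (h : ∀ i : V, ((nnGraph J).neighborSet i).encard ≤ r) (Λ : Finset V) :
    (touching J Λ).Finite :=
  touching_finite fun i _ => Set.finite_of_encard_le_coe (h i)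

/-- A proper colouring of `Λ` has no monochromatic bond meeting `Λ`, so its Boltzmann factor is
positive even for infinite couplings. -/
lemma admissible_of_encard_le (hJ : ∀ e, J e ≤ 0) {r : ℕ} (hqr : r < q)
    (h : ∀ i : V, ((nnGraph J).neighborSet i).encard ≤ r) (Λ : Finset V) :
    Admissible q J Λ := by
  intro σ
  obtain ⟨σ', h1, h2⟩ := exists_properColoring hqr h Λ σ
  refine Finset.sum_pos' (fun _ _ => boltzmann_nonneg _ _) ⟨Λ.restrict σ', Finset.mem_univ _, ?_⟩
  rw [patch_restrict_of_eq h1, boltzmann_eq_prod hJ (touching_finite_of_encard_le h Λ)]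
  refine Finset.prod_pos fun e he => ?_
  rw [Set.Finite.mem_toFinset] at he
  obtain ⟨he, i, hi, hie⟩ := he
  obtain ⟨k, rfl⟩ := Sym2.mem_iff_exists.1 hie
  have : ¬ (Sym2.map σ' s(i, k)).IsDiag := h2 i hi k he
  rw [bond, if_neg this]
  exact zero_lt_one

end Admissible

/-! ### Consistency of the specification -/

section Consistency

variable {J : Sym2 V → EReal}

lemma touching_mono {Λ Λ' : Finset V} (h : Λ ⊆ Λ') : touching J Λ ⊆ touching J Λ' :=
  fun _ ⟨he, i, hi, hie⟩ => ⟨he, i, h hi, hie⟩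

/-- Detailed balance: bonds that meet `Λ'` but not `Λ` have the same factor in `x` and `y`. The
multiplied form avoids dividing by factors that may vanish. -/
lemma boltzmann_mul_swap (hJ : ∀ e, J e ≤ 0) {Λ Λ' : Finset V} (hΛ : Λ ⊆ Λ')
    (hfin : (touching J Λ').Finite) {x y : V → Fin q} (hxy : ∀ k, k ∉ Λ → x k = y k) :
    boltzmann J Λ' x * boltzmann J Λ y = boltzmann J Λ' y * boltzmann J Λ x := by
  have hfin0 : (touching J Λ).Finite := hfin.subset (touching_mono hΛ)
  have hsub : hfin0.toFinset ⊆ hfin.toFinset := by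
    simpa using touching_mono hΛ
  rw [boltzmann_eq_prod hJ hfin, boltzmann_eq_prod hJ hfin, boltzmann_eq_prod hJ hfin0,
    boltzmann_eq_prod hJ hfin0, ← Finset.prod_sdiff hsub, ← Finset.prod_sdiff hsub]
  have : ∏ e ∈ hfin.toFinset \ hfin0.toFinset, bond J x e =
      ∏ e ∈ hfin.toFinset \ hfin0.toFinset, bond J y e := by
    refine Finset.prod_congr rfl fun e he => bond_congr fun k hk => hxy k fun hkΛ => ?_
    rw [Finset.mem_sdiff, Set.Finite.mem_toFinset, Set.Finite.mem_toFinset] at he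
    exact he.2 ⟨he.1.1, k, hkΛ, hk⟩
  rw [this]
  ring

lemma patch_patch_of_subset {Λ Λ' : Finset V} (hΛ : Λ ⊆ Λ') (η : Λ' → Fin q) (τ : Λ → Fin q)
    (σ : V → Fin q) :
    patch Λ' (Λ'.restrict (patch Λ τ (patch Λ' η σ))) σ = patch Λ τ (patch Λ' η σ) := by
  refine patch_restrict_of_eq fun k hk => ?_
  rw [patch_of_notMem _ _ fun h => hk (hΛ h), patch_of_notMem _ _ hk]

/-- Consistency of the Potts specification. -/
lemma avg_avg (hJ : ∀ e, J e ≤ 0) {Λ Λ' : Finset V} (hΛ : Λ ⊆ Λ')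
    (hfin : (touching J Λ').Finite) (hadm : Admissible q J Λ)
    (f : (V → Fin q) → ℝ) : avg J Λ' (avg J Λ f) = avg J Λ' f := by
  funext σ
  set F : (Λ' → Fin q) × (Λ → Fin q) → ℝ := fun p =>
    prob J Λ' σ p.1 * (prob J Λ (patch Λ' p.1 σ) p.2 * f (patch Λ p.2 (patch Λ' p.1 σ))) with hF
  set G : (Λ' → Fin q) × (Λ → Fin q) → ℝ := fun p =>
    prob J Λ' σ p.1 * (prob J Λ (patch Λ' p.1 σ) p.2 * f (patch Λ' p.1 σ)) with hG
  -- The involution exchanges the spins of the first component in `Λ` with the resampled ones;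
  -- detailed balance makes it carry one double sum into the other.
  set φ : (Λ' → Fin q) × (Λ → Fin q) → (Λ' → Fin q) × (Λ → Fin q) := fun p =>
    (Λ'.restrict (patch Λ p.2 (patch Λ' p.1 σ)), Λ.restrict (patch Λ' p.1 σ)) with hφ
  have hinv : ∀ p, φ (φ p) = p := by
    rintro ⟨η, τ⟩
    simp only [hφ]
    rw [patch_patch_of_subset hΛ, restrict_patch, patch_patch, patch_restrict, restrict_patch]
  have hFG : ∀ p, F (φ p) = G p := by
    rintro ⟨η, τ⟩
    simp only [hφ, hF, hG]
    rw [patch_patch_of_subset hΛ, patch_patch, patch_restrict]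
    have hxy : ∀ k, k ∉ Λ → patch Λ' η σ k = patch Λ τ (patch Λ' η σ) k :=
      fun k hk => (patch_of_notMem _ _ hk).symm
    have := boltzmann_mul_swap hJ hΛ hfin hxy
    have hZZ : ∀ θ : Λ → Fin q, patch Λ θ (patch Λ τ (patch Λ' η σ)) = patch Λ θ (patch Λ' η σ) :=
      fun θ => patch_patch _ _ _
    rw [← mul_assoc, ← mul_assoc]
    congr 1
    simp only [prob]
    rw [patch_patch_of_subset hΛ]
    simp only [hZZ, patch_restrict]
    rw [div_mul_div_comm, div_mul_div_comm, this]
  have h1 : avg J Λ' (avg J Λ f) σ = ∑ p, F p := by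
    simp only [avg, hF, Finset.mul_sum, Fintype.sum_prod_type]
  have h2 : avg J Λ' f σ = ∑ p, G p := by
    simp only [avg, hG, ← Finset.mul_sum, ← Finset.sum_mul, Fintype.sum_prod_type, sum_prob hadm,
      one_mul]
  rw [h1, h2, ← Equiv.sum_comp (Function.Involutive.toPerm φ hinv)]
  exact Finset.sum_congr rfl fun p _ => hFG p

end Consistency

/-! ### Evolution of oscillation bounds under successive averaging -/

section Comparison

variable (c : V → V → ℝ≥0∞)

/-- The effect on a vector of oscillation bounds of averaging over the spin at `i`. -/
def step (a : V → ℝ≥0∞) (i : V) (j : V) : ℝ≥0∞ := if j = i then 0 else a j + c i j * a i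

/-- The total of the bounds `a i * w i` at the moments when the sites `i` of a list
are averaged over. -/
def cost (w : V → ℝ≥0∞) : (V → ℝ≥0∞) → List V → ℝ≥0∞
  | _, [] => 0
  | a, i :: l => a i * w i + cost w (step c a i) l

variable {c}

/-- The step trades `a i * φ i` for `a i * ∑ c i j * φ j`, and the hypothesis leaves room for `a i *
w i`. Used with two choices of `φ`: constant for contraction, exponentially decaying for
correlations. -/
lemma tsum_step_add_le {φ w : V → ℝ≥0∞} {i : V} (h : w i + ∑' j, c i j * φ j ≤ φ i)
    (a : V → ℝ≥0∞) : ∑' j, step c a i j * φ j + a i * w i ≤ ∑' j, a j * φ j := by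
  have h1 : ∑' j, step c a i j * φ j ≤
      ∑' j, ((if j = i then 0 else a j * φ j) + a i * (c i j * φ j)) := by
    refine ENNReal.tsum_le_tsum fun j => ?_
    unfold step
    split_ifs
    · simp
    · exact le_of_eq (by ring)
  rw [ENNReal.tsum_add, ENNReal.tsum_mul_left] at h1
  rw [ENNReal.tsum_eq_add_tsum_ite (f := fun j => a j * φ j) i]
  calc _ ≤ (∑' j, (if j = i then 0 else a j * φ j) + a i * ∑' j, c i j * φ j) + a i * w i := by
        gcongr
    _ = a i * (w i + ∑' j, c i j * φ j) + ∑' j, (if j = i then 0 else a j * φ j) := by ring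
    _ ≤ _ := by gcongr

lemma tsum_foldl_step_add_cost_le {φ w : V → ℝ≥0∞}
    (h : ∀ i, w i + ∑' j, c i j * φ j ≤ φ i) (l : List V) (a : V → ℝ≥0∞) :
    ∑' j, l.foldl (step c) a j * φ j + cost c w a l ≤ ∑' j, a j * φ j := by
  induction l generalizing a with
  | nil => simp [cost]
  | cons i l ih =>
    rw [List.foldl_cons, cost]
    calc _ = (∑' j, l.foldl (step c) (step c a i) j * φ j + cost c w (step c a i) l)
          + a i * w i := by ring
      _ ≤ ∑' j, step c a i j * φ j + a i * w i := by gcongr; exact ih _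
      _ ≤ _ := tsum_step_add_le (h i) a

/-- A step at another site never decreases an entry, so in a list without repetition each site still
has at least its original bound when its turn comes. -/
lemma sum_le_cost (w : ℝ≥0∞) {l : List V} (hl : l.Nodup) {a b : V → ℝ≥0∞}
    (hab : ∀ i ∈ l, b i ≤ a i) : (l.map b).sum * w ≤ cost c (fun _ => w) a l := by
  induction l generalizing a with
  | nil => simp
  | cons i l ih =>
    rw [List.map_cons, List.sum_cons, cost, add_mul]
    rw [List.nodup_cons] at hl
    refine add_le_add (by gcongr; exact hab i List.mem_cons_self) (ih hl.2 fun j hj => ?_)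
    have hji : j ≠ i := fun h => hl.1 (h ▸ hj)
    rw [step, if_neg hji]
    exact (hab j (List.mem_cons_of_mem _ hj)).trans le_self_add

lemma exists_finset_half_le {a : V → ℝ≥0∞} (ha : ∑' j, a j ≠ ∞) :
    ∃ s : Finset V, (∑' j, a j) / 2 ≤ ∑ j ∈ s, a j := by
  by_cases h0 : ∑' j, a j = 0
  · exact ⟨∅, by simp [h0]⟩
  · have h1 : (∑' j, a j) / 2 < ∑' j, a j := ENNReal.half_lt_self h0 ha
    conv_rhs at h1 => rw [ENNReal.tsum_eq_iSup_sum]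
    obtain ⟨s, hs⟩ := lt_iSup_iff.1 h1
    exact ⟨s, hs.le⟩

/-- Visiting once each site of a finite set that carries half of the total removes at least the
fraction `1 - α` of that half. -/
lemma exists_list_tsum_foldl_step_le_mul {α : ℝ} (hα0 : 0 ≤ α) (hα : α < 1)
    (hc : ∀ i, ∑' j, c i j ≤ ENNReal.ofReal α) {a : V → ℝ≥0∞} (ha : ∑' j, a j ≠ ∞) :
    ∃ l : List V, ∑' j, l.foldl (step c) a j ≤
      ENNReal.ofReal (1 - (1 - α) / 2) * ∑' j, a j := by
  obtain ⟨s, hs⟩ := exists_finset_half_le ha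
  refine ⟨s.toList, ?_⟩
  have hφ : ∀ i : V, (fun _ => ENNReal.ofReal (1 - α)) i + ∑' j, c i j * (fun _ => 1) j ≤
      (fun _ : V => (1 : ℝ≥0∞)) i := by
    intro i
    simp only [mul_one]
    calc _ ≤ ENNReal.ofReal (1 - α) + ENNReal.ofReal α := by gcongr; exact hc i
      _ = 1 := by rw [← ENNReal.ofReal_add (by linarith) hα0]; simp
  have h1 := tsum_foldl_step_add_cost_le hφ s.toList a
  have h2 := sum_le_cost (c := c) (ENNReal.ofReal (1 - α)) s.nodup_toList
    (a := a) (b := a) fun _ _ => le_rfl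
  rw [Finset.sum_map_toList] at h2
  simp only [mul_one] at h1
  set S := ∑' j, a j
  set S' := ∑' j, s.toList.foldl (step c) a j
  have h3 : S' + S / 2 * ENNReal.ofReal (1 - α) ≤ S :=
    le_trans (by gcongr; exact le_trans (by gcongr) h2) h1
  have hS' : S' ≠ ∞ := ne_top_of_le_ne_top ha (le_self_add.trans h3)
  have h4 : S'.toReal + S.toReal / 2 * (1 - α) ≤ S.toReal := by
    have := ENNReal.toReal_mono ha h3
    rwa [ENNReal.toReal_add hS' (ENNReal.mul_ne_top (ENNReal.div_ne_top ha two_ne_zero)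
      ENNReal.ofReal_ne_top), ENNReal.toReal_mul, ENNReal.toReal_div,
      ENNReal.toReal_ofReal (by linarith)] at this
  rw [← ENNReal.ofReal_toReal hS', ← ENNReal.ofReal_toReal ha, ← ENNReal.ofReal_mul (by linarith)]
  exact ENNReal.ofReal_le_ofReal (by linarith)

/-- Under Dobrushin's condition a finite total of oscillation bounds can be made arbitrarily small
by averaging over finitely many spins, one after the other. -/
lemma exists_list_tsum_foldl_step_le {α : ℝ} (hα0 : 0 ≤ α) (hα : α < 1)
    (hc : ∀ i, ∑' j, c i j ≤ ENNReal.ofReal α) {a : V → ℝ≥0∞} (ha : ∑' j, a j ≠ ∞)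
    {ε : ℝ≥0∞} (hε : 0 < ε) : ∃ l : List V, ∑' j, l.foldl (step c) a j ≤ ε := by
  set ρ := ENNReal.ofReal (1 - (1 - α) / 2)
  have hρ : ρ < 1 := by
    rw [ENNReal.ofReal_lt_one]
    linarith
  have h1 : ∀ n : ℕ, ∃ l : List V, ∑' j, l.foldl (step c) a j ≤ ρ ^ n * ∑' j, a j := by
    intro n
    induction n with
    | zero => exact ⟨[], by simp⟩
    | succ n ih =>
      obtain ⟨l, hl⟩ := ih
      have hfin : ∑' j, l.foldl (step c) a j ≠ ∞ := ne_top_of_le_ne_top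
        (ENNReal.mul_ne_top (ENNReal.pow_ne_top ENNReal.ofReal_ne_top) ha) hl
      obtain ⟨l', hl'⟩ := exists_list_tsum_foldl_step_le_mul hα0 hα hc hfin
      refine ⟨l ++ l', ?_⟩
      rw [List.foldl_append]
      refine hl'.trans ?_
      rw [pow_succ', mul_assoc]
      gcongr
  have h2 : Filter.Tendsto (fun n : ℕ => ρ ^ n * ∑' j, a j) Filter.atTop (nhds 0) := by
    have := ENNReal.Tendsto.mul_const (ENNReal.tendsto_pow_atTop_nhds_zero_of_lt_one hρ)
      (Or.inr ha)
    simpa using this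
  obtain ⟨n, hn⟩ := ((tendsto_order.1 h2).2 ε hε).exists
  obtain ⟨l, hl⟩ := h1 n
  exact ⟨l, hl.trans hn.le⟩

end Comparison

/-! ### The exponentially decaying weight -/

section ExpDecay

lemma expDecay_self (G : SimpleGraph V) (m : ℝ) (i : V) : expDecay G m i i = 1 := by
  simp [expDecay]

lemma expDecay_le_of_adj {G : SimpleGraph V} {m : ℝ} (hm : 0 ≤ m) {i k : V} (h : G.Adj i k)
    (j : V) : expDecay G m k j ≤ ENNReal.ofReal (Real.exp m) * expDecay G m i j := by
  unfold expDecay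
  by_cases hk : G.Reachable k j
  · have hi : G.Reachable i j := h.reachable.trans hk
    rw [if_pos hk, if_pos hi, ← ENNReal.ofReal_mul (Real.exp_nonneg _), ← Real.exp_add]
    refine ENNReal.ofReal_le_ofReal (Real.exp_le_exp.2 ?_)
    have h1 : G.dist i j ≤ 1 + G.dist k j := by
      obtain ⟨p, hp⟩ := hk.exists_walk_length_eq_dist
      have := SimpleGraph.dist_le (SimpleGraph.Walk.cons h p)
      rw [SimpleGraph.Walk.length_cons] at this
      omega
    have h2 : (G.dist i j : ℝ) ≤ 1 + G.dist k j := by exact_mod_cast h1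
    nlinarith
  · rw [if_neg hk]
    exact zero_le

/-- The coefficient matrix of the comparison estimates: `t` for nearest neighbours. -/
def nnCoeff (G : SimpleGraph V) (t : ℝ≥0∞) (i j : V) : ℝ≥0∞ := if G.Adj i j then t else 0

/-- Moving to a neighbour costs a factor `exp m`, so the neighbour sum is at most `r / (q - r) * exp
m` times `φ i`. The rate is chosen so that this factor is `2 * r / q < 1`, and `K` is the inverse of
the gap `1 - 2 * r / q`, which the diagonal term of `φ i` uses to absorb `w i`. -/
lemma decay_supersolution {G : SimpleGraph V} {r : ℕ} (hq : 2 * r < q)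
    (h : ∀ i, (G.neighborSet i).encard ≤ r) (w : V → ℝ≥0∞) (i : V) :
    let K := (q : ℝ) / (q - 2 * r)
    let m := Real.log (2 * (q - r) / q)
    let φ : V → ℝ≥0∞ := fun i => ENNReal.ofReal K * ∑' j, expDecay G m i j * w j
    w i + ∑' k, nnCoeff G (ENNReal.ofReal (1 / ((q : ℝ) - r))) i k * φ k ≤ φ i := by
  intro K m φ
  have hq' : 2 * (r : ℝ) < q := by exact_mod_cast hq
  have hr : (0 : ℝ) ≤ r := Nat.cast_nonneg r
  have hq0 : (0 : ℝ) < q := by linarith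
  have hM : 1 ≤ 2 * ((q : ℝ) - r) / q := by rw [le_div_iff₀ hq0]; linarith
  have hm : 0 ≤ m := Real.log_nonneg hM
  have hexp : Real.exp m = 2 * (q - r) / q := Real.exp_log (by linarith)
  have h1 : ∀ k, nnCoeff G (ENNReal.ofReal (1 / ((q : ℝ) - r))) i k * φ k ≤
      nnCoeff G (ENNReal.ofReal (1 / ((q : ℝ) - r))) i k *
        (ENNReal.ofReal (Real.exp m) * φ i) := by
    intro k
    unfold nnCoeff
    split_ifs with hk
    · gcongr
      simp only [φ]
      rw [mul_left_comm, ← ENNReal.tsum_mul_left (a := ENNReal.ofReal (Real.exp m))]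
      refine mul_le_mul' le_rfl (ENNReal.tsum_le_tsum fun j => ?_)
      rw [← mul_assoc]
      gcongr
      exact expDecay_le_of_adj hm hk j
    · simp
  have h2 : ∑' k, nnCoeff G (ENNReal.ofReal (1 / ((q : ℝ) - r))) i k * φ k ≤
      ENNReal.ofReal (2 * r / q) * φ i := by
    calc _ ≤ _ := ENNReal.tsum_le_tsum h1
      _ ≤ r * ENNReal.ofReal (1 / ((q : ℝ) - r)) * (ENNReal.ofReal (Real.exp m) * φ i) := by
        rw [ENNReal.tsum_mul_right]
        gcongr
        exact tsum_neighbor_le (h i) _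
      _ = _ := by
        rw [← mul_assoc, ← ENNReal.ofReal_natCast, ← ENNReal.ofReal_mul hr,
          ← ENNReal.ofReal_mul (mul_nonneg hr (by
            apply div_nonneg zero_le_one; linarith)), hexp]
        congr 2
        have : (q : ℝ) - r ≠ 0 := by linarith
        field_simp
  have h3 : w i ≤ ENNReal.ofReal (1 - 2 * r / q) * φ i := by
    calc w i = ENNReal.ofReal (1 - 2 * r / q) * (ENNReal.ofReal K * (expDecay G m i i * w i)) := by
          rw [← mul_assoc, ← ENNReal.ofReal_mul, expDecay_self, one_mul]
          · have : (1 - 2 * (r : ℝ) / q) * K = 1 := by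
              have : (q : ℝ) - 2 * r ≠ 0 := by linarith
              simp only [K]
              field_simp
            rw [this, ENNReal.ofReal_one, one_mul]
          · rw [sub_nonneg, div_le_one hq0]; exact hq'.le
      _ ≤ _ := by
          gcongr
          exact mul_le_mul' le_rfl (ENNReal.le_tsum (f := fun j => expDecay G m i j * w j) i)
  calc _ ≤ ENNReal.ofReal (1 - 2 * r / q) * φ i + ENNReal.ofReal (2 * r / q) * φ i :=
        add_le_add h3 h2
    _ = φ i := by
        rw [← add_mul, ← ENNReal.ofReal_add]
        · simp
        · rw [sub_nonneg, div_le_one hq0]; exact hq'.le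
        · positivity

end ExpDecay

/-! ### Oscillations -/

section Osc

lemma ofReal_abs_sub_le_osc (f : (V → Fin q) → ℝ) {i : V} {σ σ' : V → Fin q}
    (h : ∀ k, k ≠ i → σ k = σ' k) : ENNReal.ofReal |f σ - f σ'| ≤ osc f i :=
  le_iSup_of_le σ (le_iSup_of_le σ' (le_iSup_of_le h le_rfl))

lemma abs_sub_le_toReal_osc {f : (V → Fin q) → ℝ} {i : V} (hf : osc f i ≠ ∞) {σ σ' : V → Fin q}
    (h : ∀ k, k ≠ i → σ k = σ' k) : |f σ - f σ'| ≤ (osc f i).toReal :=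
  (ENNReal.ofReal_le_iff_le_toReal hf).1 (ofReal_abs_sub_le_osc f h)

lemma osc_le {f : (V → Fin q) → ℝ} {i : V} {b : ℝ≥0∞}
    (h : ∀ σ σ' : V → Fin q, (∀ k, k ≠ i → σ k = σ' k) → ENNReal.ofReal |f σ - f σ'| ≤ b) :
    osc f i ≤ b :=
  iSup_le fun σ => iSup_le fun σ' => iSup_le fun hσ => h σ σ' hσ

lemma osc_ne_top_of_bounded {f : (V → Fin q) → ℝ} (hf : ∃ C, ∀ σ, |f σ| ≤ C) (i : V) :
    osc f i ≠ ∞ := by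
  obtain ⟨C, hC⟩ := hf
  refine ne_top_of_le_ne_top (ENNReal.ofReal_ne_top (r := C + C)) (osc_le fun σ σ' _ => ?_)
  exact ENNReal.ofReal_le_ofReal ((abs_sub _ _).trans (add_le_add (hC σ) (hC σ')))

lemma ofReal_abs_sub_le_sum_osc (f : (V → Fin q) → ℝ) (Λ : Finset V) {σ σ' : V → Fin q}
    (h : ∀ k, k ∉ Λ → σ k = σ' k) : ENNReal.ofReal |f σ - f σ'| ≤ ∑ i ∈ Λ, osc f i := by
  induction Λ using Finset.induction_on generalizing σ with
  | empty =>
    have : σ = σ' := funext fun k => h k (Finset.notMem_empty k)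
    simp [this]
  | insert a Λ ha ih =>
    rw [Finset.sum_insert ha]
    have h1 := ofReal_abs_sub_le_osc f (i := a) (σ := σ) (σ' := Function.update σ a (σ' a))
      fun k hk => (Function.update_of_ne hk _ _).symm
    have h2 := ih (σ := Function.update σ a (σ' a)) fun k hk => by
      by_cases hka : k = a
      · subst hka; simp
      · rw [Function.update_of_ne hka]
        exact h k (by simp [hka, hk])
    calc _ ≤ ENNReal.ofReal (|f σ - f (Function.update σ a (σ' a))| +
          |f (Function.update σ a (σ' a)) - f σ'|) :=
          ENNReal.ofReal_le_ofReal (abs_sub_le _ _ _)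
      _ ≤ _ := by
          rw [ENNReal.ofReal_add (abs_nonneg _) (abs_nonneg _)]
          exact add_le_add h1 h2

lemma ofReal_abs_sub_le_totalOsc_of_finset (f : (V → Fin q) → ℝ) (Λ : Finset V)
    {σ σ' : V → Fin q} (h : ∀ k, k ∉ Λ → σ k = σ' k) :
    ENNReal.ofReal |f σ - f σ'| ≤ totalOsc f :=
  (ofReal_abs_sub_le_sum_osc f Λ h).trans (ENNReal.sum_le_tsum _)

/-- Changing `σ'` into `σ` on growing finite volumes converges to `σ` pointwise, so continuity
passes the finite-volume bound to the limit. Without continuity it can fail: a tail function has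
zero oscillations without being constant. -/
lemma ofReal_abs_sub_le_totalOsc {f : (V → Fin q) → ℝ} (hf : Continuous f) (σ σ' : V → Fin q) :
    ENNReal.ofReal |f σ - f σ'| ≤ totalOsc f := by
  have h1 : Filter.Tendsto (fun Λ : Finset V => patch Λ (Λ.restrict σ) σ') Filter.atTop
      (nhds σ) := by
    rw [tendsto_pi_nhds]
    intro k
    refine tendsto_const_nhds.congr' ?_
    filter_upwards [Filter.eventually_ge_atTop {k}] with Λ hΛ
    rw [patch_of_mem _ _ (hΛ (Finset.mem_singleton_self k))]
    rfl
  have h2 : Filter.Tendsto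
      (fun Λ : Finset V => ENNReal.ofReal |f (patch Λ (Λ.restrict σ) σ') - f σ'|)
      Filter.atTop (nhds (ENNReal.ofReal |f σ - f σ'|)) :=
    ENNReal.tendsto_ofReal (((hf.tendsto σ).comp h1).sub_const _).abs
  exact le_of_tendsto' h2 fun Λ =>
    ofReal_abs_sub_le_totalOsc_of_finset f Λ fun k hk => patch_of_notMem _ _ hk

end Osc

/-! ### Continuity, measurability and boundedness of averages -/

section Regularity

variable {J : Sym2 V → EReal}

lemma continuous_patch (Λ : Finset V) (τ : Λ → Fin q) :
    Continuous fun σ : V → Fin q => patch Λ τ σ := by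
  refine continuous_pi fun k => ?_
  by_cases hk : k ∈ Λ
  · simp only [patch_of_mem _ _ hk]
    exact continuous_const
  · simp only [patch_of_notMem _ _ hk]
    exact continuous_apply k

lemma continuous_bond (e : Sym2 V) : Continuous fun σ : V → Fin q => bond J σ e := by
  induction e using Sym2.ind with
  | _ i j =>
    have h1 : Continuous fun p : Fin q × Fin q =>
        if p.1 = p.2 then (EReal.exp (J s(i, j))).toReal else 1 := continuous_of_discreteTopology
    have h2 : Continuous fun σ : V → Fin q => (σ i, σ j) :=
      (continuous_apply i).prodMk (continuous_apply j)
    simpa [bond, Function.comp_def] using h1.comp h2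

lemma continuous_boltzmann (hJ : ∀ e, J e ≤ 0) {Λ : Finset V} (h : (touching J Λ).Finite) :
    Continuous fun σ : V → Fin q => boltzmann J Λ σ := by
  simp only [boltzmann_eq_prod hJ h]
  exact continuous_finsetProd _ fun e _ => continuous_bond e

lemma continuous_prob (hJ : ∀ e, J e ≤ 0) {Λ : Finset V} (h : (touching J Λ).Finite)
    (ha : Admissible q J Λ) (τ : Λ → Fin q) : Continuous fun σ => prob J Λ σ τ := by
  have h1 : ∀ η : Λ → Fin q, Continuous fun σ => boltzmann J Λ (patch Λ η σ) :=
    fun η => (continuous_boltzmann hJ h).comp (continuous_patch Λ η)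
  exact (h1 τ).div (continuous_finsetSum _ fun η _ => h1 η) fun σ => (ha σ).ne'

lemma continuous_avg (hJ : ∀ e, J e ≤ 0) {Λ : Finset V} (h : (touching J Λ).Finite)
    (ha : Admissible q J Λ) {f : (V → Fin q) → ℝ} (hf : Continuous f) :
    Continuous (avg J Λ f) :=
  continuous_finsetSum _ fun τ _ =>
    (continuous_prob hJ h ha τ).mul (hf.comp (continuous_patch Λ τ))

lemma measurable_patch (Λ : Finset V) (τ : Λ → Fin q) :
    Measurable fun σ : V → Fin q => patch Λ τ σ := by
  refine measurable_pi_iff.2 fun k => ?_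
  by_cases hk : k ∈ Λ
  · simp only [patch_of_mem _ _ hk]
    exact measurable_const
  · simp only [patch_of_notMem _ _ hk]
    exact measurable_pi_apply k

lemma measurable_prob [Countable V] (hJ : ∀ e, J e ≤ 0) {Λ : Finset V}
    (h : (touching J Λ).Finite) (ha : Admissible q J Λ) (τ : Λ → Fin q) :
    Measurable fun σ => prob J Λ σ τ := (continuous_prob hJ h ha τ).measurable

lemma measurable_avg [Countable V] (hJ : ∀ e, J e ≤ 0) {Λ : Finset V}
    (h : (touching J Λ).Finite) (ha : Admissible q J Λ) {f : (V → Fin q) → ℝ}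
    (hf : Measurable f) : Measurable (avg J Λ f) :=
  Finset.measurable_sum _ fun τ _ =>
    (measurable_prob hJ h ha τ).mul (hf.comp (measurable_patch Λ τ))

lemma abs_sum_prob_mul_le {Λ : Finset V} (ha : Admissible q J Λ) (σ : V → Fin q)
    {F : (Λ → Fin q) → ℝ} {C : ℝ} (hF : ∀ τ, |F τ| ≤ C) :
    |∑ τ, prob J Λ σ τ * F τ| ≤ C := by
  calc _ ≤ ∑ τ, |prob J Λ σ τ * F τ| := Finset.abs_sum_le_sum_abs _ _
    _ ≤ ∑ τ, prob J Λ σ τ * C := by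
        refine Finset.sum_le_sum fun τ _ => ?_
        rw [abs_mul, abs_of_nonneg (prob_nonneg _ _ _)]
        exact mul_le_mul_of_nonneg_left (hF τ) (prob_nonneg _ _ _)
    _ = C := by rw [← Finset.sum_mul, sum_prob ha, one_mul]

lemma bounded_avg {Λ : Finset V} (ha : Admissible q J Λ) {f : (V → Fin q) → ℝ}
    (hf : ∃ C, ∀ σ, |f σ| ≤ C) : ∃ C, ∀ σ, |avg J Λ f σ| ≤ C :=
  let ⟨C, hC⟩ := hf
  ⟨C, fun σ => abs_sum_prob_mul_le ha σ fun _ => hC _⟩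

lemma avg_congr {Λ : Finset V} (f : (V → Fin q) → ℝ) {σ σ' : V → Fin q}
    (h : ∀ k, k ∉ Λ → σ k = σ' k) : avg J Λ f σ = avg J Λ f σ' := by
  unfold avg
  refine Finset.sum_congr rfl fun τ _ => ?_
  rw [prob_congr h, patch_congr τ h]

lemma avg_patch {Λ : Finset V} (f : (V → Fin q) → ℝ) (τ : Λ → Fin q) (σ : V → Fin q) :
    avg J Λ f (patch Λ τ σ) = avg J Λ f σ :=
  avg_congr f fun _ hk => patch_of_notMem _ _ hk

end Regularity

/-! ### Oscillations of averaged observables -/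

section OscAvg

variable {J : Sym2 V → EReal} {r : ℕ}

/-- The interdependence matrix of the Potts model with at most `r` nearest neighbours. -/
abbrev potts (q r : ℕ) (J : Sym2 V → EReal) : V → V → ℝ≥0∞ :=
  nnCoeff (nnGraph J) (ENNReal.ofReal (1 / ((q : ℝ) - r)))

lemma eq_off_of_singleton {i : V} (τ τ' : ({i} : Finset V) → Fin q) (σ : V → Fin q) :
    ∀ k, k ≠ i → patch {i} τ σ k = patch {i} τ' σ k := fun k hk => by
  have : k ∉ ({i} : Finset V) := by simpa using hk
  rw [patch_of_notMem _ _ this, patch_of_notMem _ _ this]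

lemma abs_sum_prob_sub_patch_le (hJ : ∀ e, J e ≤ 0) (hqr : r < q)
    (h : ∀ i : V, ((nnGraph J).neighborSet i).encard ≤ r) {f : (V → Fin q) → ℝ} {i j : V}
    (hi : osc f i ≠ ∞) {σ σ' : V → Fin q} (hσ : ∀ k, k ≠ j → σ k = σ' k) :
    ENNReal.ofReal |∑ τ, prob J {i} σ τ * f (patch {i} τ σ') -
      ∑ τ, prob J {i} σ' τ * f (patch {i} τ σ')| ≤ potts q r J i j * osc f i := by
  have hqr' : (r : ℝ) < q := by exact_mod_cast hqr
  by_cases hij : (nnGraph J).Adj i j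
  · rw [potts, nnCoeff, if_pos hij, ← ENNReal.ofReal_toReal hi, ← ENNReal.ofReal_mul
      (div_nonneg zero_le_one (by linarith)), one_div, mul_comm, ← div_eq_mul_inv]
    refine ENNReal.ofReal_le_ofReal ?_
    have hne : Nonempty (({i} : Finset V) → Fin q) := ⟨fun _ => ⟨0, by omega⟩⟩
    -- Subtracting the minimum over the spin at `i` gives values in `[0, osc f i]` and changes both
    -- expectations by the same constant.
    obtain ⟨η, hη⟩ := Finite.exists_min fun τ : ({i} : Finset V) → Fin q => f (patch {i} τ σ')
    have h1 := abs_sum_prob_sub_le hJ hqr (h i) hσ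
      (F := fun τ => f (patch {i} τ σ') - f (patch {i} η σ')) (D := (osc f i).toReal)
      (fun τ => sub_nonneg.2 (hη τ))
      (fun τ => (le_abs_self _).trans (abs_sub_le_toReal_osc hi (eq_off_of_singleton τ η σ')))
    have hadm := admissible_singleton hJ hqr (h i)
    simp only [mul_sub, Finset.sum_sub_distrib, ← Finset.sum_mul, sum_prob hadm] at h1
    simpa using h1
  · have : ∀ τ, prob J {i} σ τ = prob J {i} σ' τ :=
      prob_singleton_congr hJ (Set.finite_of_encard_le_coe (h i)) fun k hk =>
        hσ k fun hkj => hij (hkj ▸ hk)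
    simp [this]

/-- For `j ≠ i` the change at `j` acts through the integrand, giving `osc f j`, and through the
kernel, giving the interdependence coefficient times `osc f i`. The average does not depend on the
spin at `i` itself. -/
lemma osc_avg_le (hJ : ∀ e, J e ≤ 0) (hqr : r < q)
    (h : ∀ i : V, ((nnGraph J).neighborSet i).encard ≤ r) {f : (V → Fin q) → ℝ} {i : V}
    (hf : ∀ j, osc f j ≠ ∞) {a : V → ℝ≥0∞} (ha : ∀ j, osc f j ≤ a j) (j : V) :
    osc (avg J {i} f) j ≤ step (potts q r J) a i j := by
  unfold step
  split_ifs with hji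
  · subst hji
    refine osc_le fun σ σ' hσ => ?_
    rw [avg_congr f fun k hk => hσ k (by simpa using hk)]
    simp
  · refine osc_le fun σ σ' hσ => ?_
    have h1 : |∑ τ, prob J {i} σ τ * (f (patch {i} τ σ) - f (patch {i} τ σ'))| ≤
        (osc f j).toReal :=
      abs_sum_prob_mul_le (admissible_singleton hJ hqr (h i)) σ fun τ =>
        abs_sub_le_toReal_osc (hf j) (patch_comm_single τ hσ)
    have h2 := abs_sum_prob_sub_patch_le hJ hqr h (hf i) hσ
    have h3 : avg J {i} f σ - avg J {i} f σ' =
        ∑ τ, prob J {i} σ τ * (f (patch {i} τ σ) - f (patch {i} τ σ')) +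
        (∑ τ, prob J {i} σ τ * f (patch {i} τ σ') -
          ∑ τ, prob J {i} σ' τ * f (patch {i} τ σ')) := by
      simp only [avg, mul_sub, Finset.sum_sub_distrib]
      ring
    rw [h3]
    calc _ ≤ ENNReal.ofReal (|∑ τ, prob J {i} σ τ * (f (patch {i} τ σ) - f (patch {i} τ σ'))| +
          |∑ τ, prob J {i} σ τ * f (patch {i} τ σ') -
            ∑ τ, prob J {i} σ' τ * f (patch {i} τ σ')|) :=
          ENNReal.ofReal_le_ofReal (abs_add_le _ _)
      _ ≤ osc f j + potts q r J i j * osc f i := by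
          rw [ENNReal.ofReal_add (abs_nonneg _) (abs_nonneg _)]
          refine add_le_add ?_ h2
          exact (ENNReal.ofReal_le_iff_le_toReal (hf j)).2 h1
      _ ≤ _ := add_le_add (ha j) (mul_le_mul' le_rfl (ha i))

/-- Averaging over finitely many spins, one after the other. -/
def sweep (J : Sym2 V → EReal) (l : List V) (f : (V → Fin q) → ℝ) : (V → Fin q) → ℝ :=
  l.foldl (fun f i => avg J {i} f) f

lemma sweep_induction {P : ((V → Fin q) → ℝ) → Prop} (hP : ∀ f i, P f → P (avg J {i} f))
    (l : List V) {f : (V → Fin q) → ℝ} (hf : P f) : P (sweep J l f) := by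
  induction l generalizing f with
  | nil => exact hf
  | cons i l ih => exact ih (hP f i hf)

lemma bounded_sweep (hJ : ∀ e, J e ≤ 0) (hqr : r < q)
    (h : ∀ i : V, ((nnGraph J).neighborSet i).encard ≤ r) (l : List V)
    {f : (V → Fin q) → ℝ} (hf : ∃ C, ∀ σ, |f σ| ≤ C) : ∃ C, ∀ σ, |sweep J l f σ| ≤ C :=
  sweep_induction (P := fun f => ∃ C, ∀ σ, |f σ| ≤ C)
    (fun _ i hf => bounded_avg (admissible_singleton hJ hqr (h i)) hf) l hf

lemma measurable_sweep [Countable V] (hJ : ∀ e, J e ≤ 0) (hqr : r < q)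
    (h : ∀ i : V, ((nnGraph J).neighborSet i).encard ≤ r) (l : List V)
    {f : (V → Fin q) → ℝ} (hf : Measurable f) : Measurable (sweep J l f) :=
  sweep_induction (P := Measurable) (fun _ i hf => measurable_avg hJ
    (touching_finite_of_encard_le h {i}) (admissible_singleton hJ hqr (h i)) hf) l hf

lemma continuous_sweep (hJ : ∀ e, J e ≤ 0) (hqr : r < q)
    (h : ∀ i : V, ((nnGraph J).neighborSet i).encard ≤ r) (l : List V)
    {f : (V → Fin q) → ℝ} (hf : Continuous f) : Continuous (sweep J l f) :=
  sweep_induction (P := Continuous) (fun _ i hf => continuous_avg hJ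
    (touching_finite_of_encard_le h {i}) (admissible_singleton hJ hqr (h i)) hf) l hf

lemma osc_sweep_le (hJ : ∀ e, J e ≤ 0) (hqr : r < q)
    (h : ∀ i : V, ((nnGraph J).neighborSet i).encard ≤ r) (l : List V)
    {f : (V → Fin q) → ℝ} (hf : ∃ C, ∀ σ, |f σ| ≤ C) {a : V → ℝ≥0∞} (ha : ∀ j, osc f j ≤ a j)
    (j : V) : osc (sweep J l f) j ≤ l.foldl (step (potts q r J)) a j := by
  induction l generalizing f a with
  | nil => exact ha j
  | cons i l ih =>
    exact ih (bounded_avg (admissible_singleton hJ hqr (h i)) hf)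
      (osc_avg_le hJ hqr h (osc_ne_top_of_bounded hf) ha)

lemma exists_totalOsc_sweep_le (hJ : ∀ e, J e ≤ 0) (hq : 2 * r < q)
    (h : ∀ i : V, ((nnGraph J).neighborSet i).encard ≤ r) {f : (V → Fin q) → ℝ}
    (hf : ∃ C, ∀ σ, |f σ| ≤ C) (hosc : totalOsc f ≠ ∞) {ε : ℝ≥0∞} (hε : 0 < ε) :
    ∃ l : List V, totalOsc (sweep J l f) ≤ ε := by
  have hq' : 2 * (r : ℝ) < q := by exact_mod_cast hq
  have hr : (0 : ℝ) ≤ r := Nat.cast_nonneg r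
  have h0 : 0 < (q : ℝ) - r := by linarith
  have hc : ∀ i, ∑' j, potts q r J i j ≤ ENNReal.ofReal ((r : ℝ) / ((q : ℝ) - r)) := fun i => by
    refine (tsum_neighbor_le (h i) _).trans_eq ?_
    rw [← ENNReal.ofReal_natCast, ← ENNReal.ofReal_mul hr]
    congr 1
    ring
  obtain ⟨l, hl⟩ := exists_list_tsum_foldl_step_le (div_nonneg hr h0.le)
    (by rw [div_lt_one h0]; linarith) hc hosc hε
  exact ⟨l, (ENNReal.tsum_le_tsum fun j =>
    osc_sweep_le hJ (by omega) h l hf (fun _ => le_rfl) j).trans hl⟩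

end OscAvg

/-! ### Bounded functions -/

section Bounded

lemma integrable_of_bounded {Ω : Type*} [MeasurableSpace Ω] {μ : Measure Ω} [IsFiniteMeasure μ]
    {f : Ω → ℝ} (hf : Measurable f) (hb : ∃ C, ∀ x, |f x| ≤ C) : Integrable f μ :=
  let ⟨C, hC⟩ := hb
  .of_bound hf.aestronglyMeasurable C (.of_forall hC)

lemma bounded_mul {Ω : Type*} {f g : Ω → ℝ} (hf : ∃ C, ∀ x, |f x| ≤ C)
    (hg : ∃ C, ∀ x, |g x| ≤ C) : ∃ C, ∀ x, |f x * g x| ≤ C := by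
  obtain ⟨C, hC⟩ := hf
  obtain ⟨D, hD⟩ := hg
  refine ⟨C * D, fun x => ?_⟩
  rw [abs_mul]
  exact mul_le_mul (hC x) (hD x) (abs_nonneg _) ((abs_nonneg _).trans (hC x))

lemma integrable_mul_of_bounded {Ω : Type*} [MeasurableSpace Ω] {μ : Measure Ω}
    [IsFiniteMeasure μ] {f g : Ω → ℝ} (hf : Measurable f) (hfb : ∃ C, ∀ x, |f x| ≤ C)
    (hg : Measurable g) (hgb : ∃ C, ∀ x, |g x| ≤ C) : Integrable (fun x => f x * g x) μ :=
  integrable_of_bounded (hf.mul hg) (bounded_mul hfb hgb)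

lemma bounded_sub {Ω : Type*} {f g : Ω → ℝ} (hf : ∃ C, ∀ x, |f x| ≤ C)
    (hg : ∃ C, ∀ x, |g x| ≤ C) : ∃ C, ∀ x, |f x - g x| ≤ C := by
  obtain ⟨C, hC⟩ := hf
  obtain ⟨D, hD⟩ := hg
  exact ⟨C + D, fun x => (abs_sub _ _).trans (add_le_add (hC x) (hD x))⟩

end Bounded

/-! ### Cylinder events -/

section Cylinder

lemma continuous_and_totalOsc_cylinder_indicator {C : Set (V → Fin q)}
    (hC : C ∈ measurableCylinders fun _ : V => Fin q) :
    Continuous (C.indicator (1 : (V → Fin q) → ℝ)) ∧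
      totalOsc (C.indicator (1 : (V → Fin q) → ℝ)) ≠ ∞ := by
  obtain ⟨s, S, -, rfl⟩ := (mem_measurableCylinders _).1 hC
  constructor
  · have h1 : Continuous (S.indicator (1 : (s → Fin q) → ℝ)) := continuous_of_discreteTopology
    exact h1.comp (continuous_pi fun k => continuous_apply (k : V))
  · have hb : ∃ C, ∀ σ, |(cylinder s S).indicator (1 : (V → Fin q) → ℝ) σ| ≤ C :=
      ⟨1, fun σ => by by_cases hσ : σ ∈ cylinder s S <;> simp [hσ]⟩
    rw [totalOsc, tsum_eq_sum (s := s) fun i hi => ?_]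
    · exact (ENNReal.sum_lt_top.2 fun i _ => (osc_ne_top_of_bounded hb i).lt_top).ne
    · refine le_antisymm (osc_le fun σ σ' hσ => ?_) zero_le
      have : s.restrict σ = s.restrict σ' := funext fun k => hσ k fun hk => hi (hk ▸ k.2)
      have h2 : σ ∈ cylinder s S ↔ σ' ∈ cylinder s S := by simp [mem_cylinder, this]
      by_cases hσ' : σ' ∈ cylinder s S
      · simp [hσ', h2.2 hσ']
      · simp [hσ', mt h2.1 hσ']

lemma bounded_indicator {Ω : Type*} (A : Set Ω) :
    ∃ C, ∀ x, |A.indicator (1 : Ω → ℝ) x| ≤ C :=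
  ⟨1, fun x => by by_cases hx : x ∈ A <;> simp [hx]⟩

lemma ext_of_cylinder_integral {μ ν : Measure (V → Fin q)} [IsProbabilityMeasure μ]
    [IsFiniteMeasure ν]
    (h : ∀ C ∈ measurableCylinders fun _ : V => Fin q,
      ∫ σ, C.indicator 1 σ ∂μ = ∫ σ, C.indicator (1 : (V → Fin q) → ℝ) σ ∂ν) : μ = ν := by
  have h1 : ∀ C ∈ measurableCylinders fun _ : V => Fin q, μ C = ν C := by
    intro C hC
    have hm : MeasurableSet C := MeasurableSet.of_mem_measurableCylinders hC
    have := h C hC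
    rw [integral_indicator_one hm, integral_indicator_one hm] at this
    exact (ENNReal.toReal_eq_toReal_iff' (measure_ne_top _ _) (measure_ne_top _ _)).1 this
  exact ext_of_generate_finite _ generateFrom_measurableCylinders.symm
    isPiSystem_measurableCylinders h1 (h1 _ (univ_mem_measurableCylinders _))

end Cylinder

/-! ### Covariances and uniqueness for invariant measures -/

section Invariant

variable [Countable V] {J : Sym2 V → EReal} {r : ℕ}

/-- `μ` is invariant under resampling any single spin from its conditional distribution. -/
def Invariant (J : Sym2 V → EReal) (μ : Measure (V → Fin q)) : Prop :=
  ∀ (i : V) (F : (V → Fin q) → ℝ), Measurable F → (∃ C, ∀ σ, |F σ| ≤ C) →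
    ∫ σ, avg J {i} F σ ∂μ = ∫ σ, F σ ∂μ

lemma integral_sweep (hJ : ∀ e, J e ≤ 0) (hqr : r < q)
    (h : ∀ i : V, ((nnGraph J).neighborSet i).encard ≤ r) {μ : Measure (V → Fin q)}
    (hμ : Invariant J μ) (l : List V)
    {f : (V → Fin q) → ℝ} (hf : Measurable f) (hb : ∃ C, ∀ σ, |f σ| ≤ C) :
    ∫ σ, sweep J l f σ ∂μ = ∫ σ, f σ ∂μ := by
  induction l generalizing f with
  | nil => rfl
  | cons i l ih =>
    have hadm := admissible_singleton (q := q) hJ hqr (h i)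
    exact (ih (measurable_avg hJ (touching_finite_of_encard_le h {i}) hadm hf)
      (bounded_avg hadm hb)).trans (hμ i f hf hb)

lemma abs_integral_le_of_forall {Ω : Type*} [MeasurableSpace Ω] {μ : Measure Ω}
    [IsProbabilityMeasure μ] {f : Ω → ℝ} {C : ℝ} (h : ∀ᵐ x ∂μ, |f x| ≤ C) :
    |∫ x, f x ∂μ| ≤ C := by
  simpa using norm_integral_le_of_norm_le_const (f := f) h

/-- Given the other spins, `f - avg J {i} f` has mean zero, so `g` may be replaced by its deviation
from its value at the current configuration, which is at most `osc g i`. -/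
lemma abs_integral_sub_avg_mul_le (hJ : ∀ e, J e ≤ 0) (hqr : r < q)
    (h : ∀ i : V, ((nnGraph J).neighborSet i).encard ≤ r) {μ : Measure (V → Fin q)}
    [IsProbabilityMeasure μ] (hμ : Invariant J μ) (i : V)
    {f g : (V → Fin q) → ℝ} (hf : Measurable f) (hfb : ∃ C, ∀ σ, |f σ| ≤ C)
    (hg : Measurable g) (hgb : ∃ C, ∀ σ, |g σ| ≤ C) :
    ENNReal.ofReal |∫ σ, (f σ - avg J {i} f σ) * g σ ∂μ| ≤ osc f i * osc g i := by
  have hadm := admissible_singleton (q := q) hJ hqr (h i)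
  have hav := measurable_avg hJ (touching_finite_of_encard_le h {i}) hadm hf
  have hof := osc_ne_top_of_bounded hfb i
  have hog := osc_ne_top_of_bounded hgb i
  rw [← hμ i (fun σ => (f σ - avg J {i} f σ) * g σ) ((hf.sub hav).mul hg) (bounded_mul (bounded_sub hfb (bounded_avg hadm hfb)) hgb),
    ← ENNReal.ofReal_toReal hof, ← ENNReal.ofReal_toReal hog,
    ← ENNReal.ofReal_mul ENNReal.toReal_nonneg]
  refine ENNReal.ofReal_le_ofReal (abs_integral_le_of_forall (.of_forall fun σ => ?_))
  have hself : ∀ τ k, k ≠ i → patch {i} τ σ k = σ k := fun τ k hk =>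
    patch_of_notMem _ _ (by simpa using hk)
  have h1 : avg J {i} (fun σ => (f σ - avg J {i} f σ) * g σ) σ =
      ∑ τ, prob J {i} σ τ * ((f (patch {i} τ σ) - avg J {i} f σ) *
        (g (patch {i} τ σ) - g σ)) := by
    have h2 : ∑ τ, prob J {i} σ τ * ((f (patch {i} τ σ) - avg J {i} f σ) * g σ) = 0 := by
      simp only [← mul_assoc, ← Finset.sum_mul, mul_sub, Finset.sum_sub_distrib, sum_prob hadm,
        one_mul]
      simp [avg]
    rw [avg]
    simp only [avg_patch]
    rw [← sub_zero (∑ τ, _), ← h2, ← Finset.sum_sub_distrib]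
    exact Finset.sum_congr rfl fun τ _ => by ring
  change |avg J {i} (fun σ => (f σ - avg J {i} f σ) * g σ) σ| ≤ _
  rw [h1]
  refine abs_sum_prob_mul_le hadm σ fun τ => ?_
  rw [abs_mul]
  refine mul_le_mul ?_ (abs_sub_le_toReal_osc hog (hself τ)) (abs_nonneg _)
    ENNReal.toReal_nonneg
  have h3 : f (patch {i} τ σ) - avg J {i} f σ =
      ∑ η, prob J {i} σ η * (f (patch {i} τ σ) - f (patch {i} η σ)) := by
    simp only [mul_sub, Finset.sum_sub_distrib, ← Finset.sum_mul, sum_prob hadm, one_mul]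
    rfl
  rw [h3]
  exact abs_sum_prob_mul_le hadm σ fun η =>
    abs_sub_le_toReal_osc hof (eq_off_of_singleton τ η σ)

/-- Telescoping: averaging at `i` changes the covariance by `∫ (f - avg J {i} f) * g`, at most `a i
* osc g i` for the current oscillation bounds `a`, which is the increment recorded by `cost`. -/
lemma cov_le_cost_add (hJ : ∀ e, J e ≤ 0) (hqr : r < q)
    (h : ∀ i : V, ((nnGraph J).neighborSet i).encard ≤ r) {μ : Measure (V → Fin q)}
    [IsProbabilityMeasure μ] (hμ : Invariant J μ) (l : List V)
    {f g : (V → Fin q) → ℝ} (hf : Measurable f) (hfb : ∃ C, ∀ σ, |f σ| ≤ C)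
    (hg : Measurable g) (hgb : ∃ C, ∀ σ, |g σ| ≤ C) {a : V → ℝ≥0∞} (ha : ∀ j, osc f j ≤ a j) :
    ENNReal.ofReal |∫ σ, f σ * g σ ∂μ - (∫ σ, f σ ∂μ) * ∫ σ, g σ ∂μ| ≤
      cost (potts q r J) (osc g) a l + ENNReal.ofReal
        |∫ σ, sweep J l f σ * g σ ∂μ - (∫ σ, sweep J l f σ ∂μ) * ∫ σ, g σ ∂μ| := by
  induction l generalizing f a with
  | nil => simp [cost, sweep]
  | cons i l ih =>
    have hadm := admissible_singleton (q := q) hJ hqr (h i)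
    have hav := measurable_avg hJ (touching_finite_of_encard_le h {i}) hadm hf
    have havb := bounded_avg hadm hfb
    have h1 := ih hav havb (osc_avg_le hJ hqr h (osc_ne_top_of_bounded hfb) ha)
    have h2 := abs_integral_sub_avg_mul_le hJ hqr h hμ i hf hfb hg hgb
    have h3 : ∫ σ, f σ * g σ ∂μ - (∫ σ, f σ ∂μ) * ∫ σ, g σ ∂μ =
        ∫ σ, (f σ - avg J {i} f σ) * g σ ∂μ +
        (∫ σ, avg J {i} f σ * g σ ∂μ - (∫ σ, avg J {i} f σ ∂μ) * ∫ σ, g σ ∂μ) := by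
      simp only [sub_mul]
      rw [integral_sub (integrable_mul_of_bounded hf hfb hg hgb)
        (integrable_mul_of_bounded hav havb hg hgb), hμ i f hf hfb]
      ring
    rw [h3, cost, add_assoc]
    calc _ ≤ _ := ENNReal.ofReal_le_ofReal (abs_add_le _ _)
      _ = _ := ENNReal.ofReal_add (abs_nonneg _) (abs_nonneg _)
      _ ≤ _ := add_le_add (h2.trans (mul_le_mul' (ha i) le_rfl)) h1

lemma abs_cov_le_of_ae_close {Ω : Type*} [MeasurableSpace Ω] {μ : Measure Ω}
    [IsProbabilityMeasure μ] {f g : Ω → ℝ} (hf : Measurable f) (hfb : ∃ C, ∀ x, |f x| ≤ C)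
    (hg : Measurable g) {C ε c : ℝ} (hgb : ∀ x, |g x| ≤ C) (hc : ∀ᵐ x ∂μ, |f x - c| ≤ ε) :
    |∫ x, f x * g x ∂μ - (∫ x, f x ∂μ) * ∫ x, g x ∂μ| ≤ 2 * ε * C := by
  have hgi := integrable_of_bounded (μ := μ) hg ⟨C, hgb⟩
  have hfi := integrable_of_bounded (μ := μ) hf hfb
  have hfg := integrable_mul_of_bounded (μ := μ) hf hfb hg ⟨C, hgb⟩
  obtain ⟨x, hx⟩ := hc.exists
  have hε : 0 ≤ ε := (abs_nonneg _).trans hx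
  have h1 : |∫ x, (f x - c) * g x ∂μ| ≤ ε * C := by
    refine abs_integral_le_of_forall ?_
    filter_upwards [hc] with x hx
    rw [abs_mul]
    exact mul_le_mul hx (hgb x) (abs_nonneg _) hε
  have h2 : |(∫ x, (f x - c) ∂μ) * ∫ x, g x ∂μ| ≤ ε * C := by
    rw [abs_mul]
    exact mul_le_mul (abs_integral_le_of_forall hc)
      (abs_integral_le_of_forall (.of_forall hgb)) (abs_nonneg _) hε
  have h3 : ∫ x, f x * g x ∂μ - (∫ x, f x ∂μ) * ∫ x, g x ∂μ =
      ∫ x, (f x - c) * g x ∂μ - (∫ x, (f x - c) ∂μ) * ∫ x, g x ∂μ := by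
    simp only [sub_mul]
    rw [integral_sub hfg (hgi.const_mul c), integral_sub hfi (integrable_const c),
      integral_const_mul]
    simp
    ring
  rw [h3]
  calc _ ≤ _ := abs_sub _ _
    _ ≤ _ := add_le_add h1 h2
    _ = _ := by ring

/-- The covariance estimate for bounded observables, if the averages of `f` are almost surely
within their total oscillation of a constant. -/
lemma cov_le_of_close (hJ : ∀ e, J e ≤ 0) (hq : 2 * r < q)
    (h : ∀ i : V, ((nnGraph J).neighborSet i).encard ≤ r) {μ : Measure (V → Fin q)}
    [IsProbabilityMeasure μ] (hμ : Invariant J μ)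
    {f g : (V → Fin q) → ℝ} (hf : Measurable f) (hfb : ∃ C, ∀ σ, |f σ| ≤ C)
    (hosc : totalOsc f ≠ ∞) (hg : Measurable g) (hgb : ∃ C, ∀ σ, |g σ| ≤ C)
    (hclose : ∀ l, totalOsc (sweep J l f) ≠ ∞ →
      ∃ c, ∀ᵐ σ ∂μ, |sweep J l f σ - c| ≤ (totalOsc (sweep J l f)).toReal) :
    ENNReal.ofReal |∫ σ, f σ * g σ ∂μ - (∫ σ, f σ ∂μ) * ∫ σ, g σ ∂μ| ≤
      ENNReal.ofReal ((q : ℝ) / (q - 2 * r)) * ∑' (i : V) (j : V),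
        osc f i * expDecay (nnGraph J) (Real.log (2 * (q - r) / q)) i j * osc g j := by
  have hqr : r < q := by omega
  have hcost : ∀ l, cost (potts q r J) (osc g) (osc f) l ≤
      ENNReal.ofReal ((q : ℝ) / (q - 2 * r)) * ∑' (i : V) (j : V),
        osc f i * expDecay (nnGraph J) (Real.log (2 * (q - r) / q)) i j * osc g j := by
    intro l
    refine (le_add_self.trans (tsum_foldl_step_add_cost_le
      (decay_supersolution hq h (osc g)) l (osc f))).trans_eq ?_
    rw [← ENNReal.tsum_mul_left]
    refine tsum_congr fun i => ?_
    simp only [mul_assoc]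
    rw [ENNReal.tsum_mul_left, mul_left_comm]
  obtain ⟨C, hC⟩ := hgb
  refine ENNReal.le_of_forall_pos_le_add fun ε hε _ => ?_
  obtain ⟨σ₀⟩ : Nonempty (V → Fin q) := ⟨fun _ => ⟨0, by omega⟩⟩
  have hC0 : 0 ≤ C := (abs_nonneg _).trans (hC σ₀)
  -- The residual covariance is at most `2 * δ * C`; `C + 1` avoids division by zero when `C = 0`.
  have hδ : 0 < (ε : ℝ) / (2 * (C + 1)) := by positivity
  obtain ⟨l, hl⟩ := exists_totalOsc_sweep_le hJ hq h hfb hosc (ENNReal.ofReal_pos.2 hδ)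
  have hne : totalOsc (sweep J l f) ≠ ∞ := ne_top_of_le_ne_top ENNReal.ofReal_ne_top hl
  obtain ⟨c, hc⟩ := hclose l hne
  refine (cov_le_cost_add hJ hqr h hμ l hf hfb hg ⟨C, hC⟩ fun _ => le_rfl).trans
    (add_le_add (hcost l) ?_)
  have h1 := abs_cov_le_of_ae_close (measurable_sweep hJ hqr h l hf)
    (bounded_sweep hJ hqr h l hfb) hg hC hc
  rw [ENNReal.ofReal_le_iff_le_toReal ENNReal.coe_ne_top]
  refine h1.trans ?_
  have h2 : (totalOsc (sweep J l f)).toReal ≤ (ε : ℝ) / (2 * (C + 1)) :=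
    ENNReal.toReal_le_of_le_ofReal hδ.le hl
  calc _ ≤ 2 * ((ε : ℝ) / (2 * (C + 1))) * (C + 1) := by gcongr; linarith
    _ = ε := by field_simp
    _ = _ := (ENNReal.coe_toReal ε).symm

/-- Averages of a continuous observable stay continuous and hence are everywhere within their total
oscillation of any of their values. This case suffices for the zero-one law from which the general
case follows. -/
lemma cov_le_of_continuous (hJ : ∀ e, J e ≤ 0) (hq : 2 * r < q)
    (h : ∀ i : V, ((nnGraph J).neighborSet i).encard ≤ r) {μ : Measure (V → Fin q)}
    [IsProbabilityMeasure μ] (hμ : Invariant J μ)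
    {f g : (V → Fin q) → ℝ} (hf : Continuous f) (hfb : ∃ C, ∀ σ, |f σ| ≤ C)
    (hosc : totalOsc f ≠ ∞) (hg : Measurable g) (hgb : ∃ C, ∀ σ, |g σ| ≤ C) :
    ENNReal.ofReal |∫ σ, f σ * g σ ∂μ - (∫ σ, f σ ∂μ) * ∫ σ, g σ ∂μ| ≤
      ENNReal.ofReal ((q : ℝ) / (q - 2 * r)) * ∑' (i : V) (j : V),
        osc f i * expDecay (nnGraph J) (Real.log (2 * (q - r) / q)) i j * osc g j := by
  refine cov_le_of_close hJ hq h hμ hf.measurable hfb hosc hg hgb fun l hl => ?_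
  refine ⟨sweep J l f fun _ => ⟨0, by omega⟩, .of_forall fun σ => ?_⟩
  exact (ENNReal.ofReal_le_iff_le_toReal hl).1
    (ofReal_abs_sub_le_totalOsc (continuous_sweep hJ (by omega) h l hf) _ _)

/-- A long enough sweep brings a cylinder indicator uniformly close to a constant that does not
depend on the measure, while leaving its integral against either measure unchanged. -/
lemma invariant_unique (hJ : ∀ e, J e ≤ 0) (hq : 2 * r < q)
    (h : ∀ i : V, ((nnGraph J).neighborSet i).encard ≤ r) {μ ν : Measure (V → Fin q)}
    [IsProbabilityMeasure μ] [IsProbabilityMeasure ν] (hμ : Invariant J μ)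
    (hν : Invariant J ν) : μ = ν := by
  refine ext_of_cylinder_integral fun C hC => ?_
  obtain ⟨hcont, hosc⟩ := continuous_and_totalOsc_cylinder_indicator hC
  have hb := bounded_indicator C
  set f := C.indicator (1 : (V → Fin q) → ℝ)
  have hqr : r < q := by omega
  refine eq_of_forall_dist_le fun ε hε => ?_
  obtain ⟨l, hl⟩ := exists_totalOsc_sweep_le hJ hq h hb hosc
    (ENNReal.ofReal_pos.2 (half_pos hε))
  have hm := measurable_sweep hJ hqr h l hcont.measurable
  have hsb := bounded_sweep hJ hqr h l hb
  set c := sweep J l f fun _ => ⟨0, by omega⟩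
  have hc : ∀ σ, |sweep J l f σ - c| ≤ ε / 2 := fun σ =>
    (ENNReal.ofReal_le_ofReal_iff (half_pos hε).le).1
      ((ofReal_abs_sub_le_totalOsc (continuous_sweep hJ hqr h l hcont) _ _).trans hl)
  have key : ∀ (ρ : Measure (V → Fin q)) [IsProbabilityMeasure ρ], Invariant J ρ →
      |∫ σ, f σ ∂ρ - c| ≤ ε / 2 := by
    intro ρ _ hρ
    have h1 := abs_integral_le_of_forall (μ := ρ) (.of_forall hc)
    rw [integral_sub (integrable_of_bounded hm hsb) (integrable_const _),
      integral_sweep hJ hqr h hρ l hcont.measurable hb] at h1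
    simpa using h1
  have h1 := key μ hμ
  have h2 := key ν hν
  rw [Real.dist_eq]
  rw [abs_le] at *
  constructor <;> linarith

end Invariant

/-! ### The σ-algebra of the spins outside a volume -/

section Outside

lemma outside_le (Λ : Finset V) : outside q Λ ≤ MeasurableSpace.pi :=
  Measurable.comap_le (measurable_pi_iff.2 fun k => measurable_pi_apply (k : V))

lemma measurable_outside_patch (Λ : Finset V) (τ : Λ → Fin q) :
    Measurable[outside q Λ] fun σ : V → Fin q => patch Λ τ σ := by
  refine @measurable_pi_lambda _ _ _ (outside q Λ) _ _ fun k => ?_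
  by_cases hk : k ∈ Λ
  · simp only [patch_of_mem _ _ hk]
    exact measurable_const
  · simp only [patch_of_notMem _ _ hk]
    exact (measurable_pi_apply (X := fun _ : ((Λ : Set V)ᶜ : Set V) => Fin q)
      ⟨k, fun h => hk (Finset.mem_coe.1 h)⟩).comp
      (comap_measurable (Set.domRestrict (π := fun _ => Fin q) ((Λ : Set V)ᶜ)))

lemma mem_iff_of_measurableSet_outside {Λ : Finset V} {B : Set (V → Fin q)}
    (hB : MeasurableSet[outside q Λ] B) {σ σ' : V → Fin q} (h : ∀ k, k ∉ Λ → σ k = σ' k) :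
    σ ∈ B ↔ σ' ∈ B := by
  obtain ⟨B', -, rfl⟩ := hB
  have : Set.domRestrict (π := fun _ => Fin q) ((Λ : Set V)ᶜ) σ =
      Set.domRestrict (π := fun _ => Fin q) ((Λ : Set V)ᶜ) σ' :=
    funext fun k => h k fun hk => k.2 (Finset.mem_coe.2 hk)
  rw [Set.mem_preimage, Set.mem_preimage, this]

lemma measurable_outside_prob [Countable V] {J : Sym2 V → EReal} (hJ : ∀ e, J e ≤ 0)
    {Λ : Finset V} (h : (touching J Λ).Finite) (ha : Admissible q J Λ) (τ : Λ → Fin q) :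
    Measurable[outside q Λ] fun σ => prob J Λ σ τ := by
  have h1 : (fun σ => prob J Λ σ τ) = fun σ => prob J Λ (patch Λ τ σ) τ :=
    funext fun σ => prob_congr (fun k hk => (patch_of_notMem _ _ hk).symm) τ
  rw [h1]
  exact (measurable_prob hJ h ha τ).comp (measurable_outside_patch Λ τ)

end Outside

/-! ### Conditional probabilities versus integrated DLR equations -/

section DLR

variable [Countable V] {J : Sym2 V → EReal}

lemma integral_mul_condProb {μ : Measure (V → Fin q)} [IsProbabilityMeasure μ] {Λ : Finset V}
    {A : Set (V → Fin q)} (hA : MeasurableSet A) {g : (V → Fin q) → ℝ}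
    (hg : Measurable[outside q Λ] g) (hb : ∃ C, ∀ σ, |g σ| ≤ C) :
    ∫ σ, g σ * (μ⟦A | outside q Λ⟧) σ ∂μ = ∫ σ, g σ * A.indicator (fun _ => (1 : ℝ)) σ ∂μ := by
  have hg' : Measurable g := hg.mono (outside_le Λ) le_rfl
  have hAm : Measurable (A.indicator fun _ => (1 : ℝ)) := measurable_const.indicator hA
  have hAb : ∃ C, ∀ σ, |A.indicator (fun _ => (1 : ℝ)) σ| ≤ C := bounded_indicator A
  have h1 := condExp_mul_of_stronglyMeasurable_left (μ := μ) (m := outside q Λ)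
    (g := A.indicator fun _ => (1 : ℝ)) hg.stronglyMeasurable
    (integrable_mul_of_bounded hg' hb hAm hAb) (integrable_of_bounded hAm hAb)
  rw [← integral_condExp (outside_le Λ) (f := fun σ => g σ * A.indicator (fun _ => (1 : ℝ)) σ)]
  exact (integral_congr_ae h1).symm

/-- The DLR equations in integrated form. -/
lemma IsGibbs.integral_avg {μ : Measure (V → Fin q)} (hμ : IsGibbs J μ) (hJ : ∀ e, J e ≤ 0)
    {Λ : Finset V} (h : (touching J Λ).Finite) (ha : Admissible q J Λ)
    {F : (V → Fin q) → ℝ} (hF : Measurable F) (hb : ∃ C, ∀ σ, |F σ| ≤ C) :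
    ∫ σ, avg J Λ F σ ∂μ = ∫ σ, F σ ∂μ := by
  have := hμ.isProbabilityMeasure
  have hg : ∀ τ : Λ → Fin q, Measurable[outside q Λ] fun σ => F (patch Λ τ σ) :=
    fun τ => hF.comp (measurable_outside_patch Λ τ)
  have hgm : ∀ τ : Λ → Fin q, Measurable fun σ => F (patch Λ τ σ) :=
    fun τ => hF.comp (measurable_patch Λ τ)
  have hgb : ∀ τ : Λ → Fin q, ∃ C, ∀ σ, |F (patch Λ τ σ)| ≤ C :=
    fun τ => let ⟨C, hC⟩ := hb; ⟨C, fun σ => hC _⟩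
  have hset : ∀ τ : Λ → Fin q, MeasurableSet {σ : V → Fin q | Λ.restrict σ ∈ ({τ} : Set _)} :=
    fun τ => (measurable_pi_iff.2 fun k => measurable_pi_apply (k : V) :
      Measurable (Λ.restrict (π := fun _ => Fin q))) (Set.toFinite {τ}).measurableSet
  -- With `τ` fixed, `F (patch Λ τ σ)` depends only on the outside spins and `prob` is the
  -- conditional probability of `τ`, so the latter may be replaced by the indicator that the spins
  -- in `Λ` equal `τ`.
  have h1 : ∀ τ : Λ → Fin q, ∫ σ, prob J Λ σ τ * F (patch Λ τ σ) ∂μ =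
      ∫ σ, F (patch Λ τ σ) *
        {σ : V → Fin q | Λ.restrict σ ∈ ({τ} : Set _)}.indicator (fun _ => (1 : ℝ)) σ ∂μ := by
    intro τ
    rw [← integral_mul_condProb (hset τ) (hg τ) (hgb τ)]
    refine integral_congr_ae ?_
    filter_upwards [hμ.condProb_eq Λ {τ}] with σ hσ
    rw [hσ, spec_real hJ h ha, Finset.sum_eq_single τ]
    · simp [mul_comm]
    · intro η _ hη
      simp [hη]
    · simp
  have hint : ∀ τ : Λ → Fin q, Integrable (fun σ => F (patch Λ τ σ) *
      {σ : V → Fin q | Λ.restrict σ ∈ ({τ} : Set _)}.indicator (fun _ => (1 : ℝ)) σ) μ :=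
    fun τ => integrable_mul_of_bounded (hgm τ) (hgb τ)
      (measurable_const.indicator (hset τ)) (bounded_indicator _)
  unfold avg
  have hpb : ∀ τ : Λ → Fin q, ∃ C, ∀ σ, |prob J Λ σ τ| ≤ C := fun τ => ⟨1, fun σ => by
    rw [abs_of_nonneg (prob_nonneg _ _ _), ← sum_prob ha σ]
    exact Finset.single_le_sum (fun η _ => prob_nonneg Λ σ η) (Finset.mem_univ τ)⟩
  rw [integral_finsetSum _ fun τ _ => integrable_mul_of_bounded (measurable_prob hJ h ha τ)
    (hpb τ) (hgm τ) (hgb τ), Finset.sum_congr rfl fun τ _ => h1 τ,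
    ← integral_finsetSum _ fun τ _ => hint τ]
  refine integral_congr_ae (.of_forall fun σ => ?_)
  change ∑ τ : Λ → Fin q, F (patch Λ τ σ) *
    {σ : V → Fin q | Λ.restrict σ ∈ ({τ} : Set _)}.indicator (fun _ => (1 : ℝ)) σ = F σ
  rw [Finset.sum_eq_single (Λ.restrict σ)]
  · simp [patch_restrict]
  · intro η _ hη
    simp [hη.symm]
  · simp

/-- Testing the invariance on the indicator of an event in `Λ` times that of an outside event `B`
gives the defining property of conditional expectation, because resampling in `Λ` does not affect
`B`. -/
lemma isGibbs_of_integral_avg (hJ : ∀ e, J e ≤ 0) (h : ∀ Λ, (touching J Λ).Finite)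
    (ha : ∀ Λ, Admissible q J Λ) {μ : Measure (V → Fin q)} [IsProbabilityMeasure μ]
    (hμ : ∀ (Λ : Finset V) (F : (V → Fin q) → ℝ), Measurable F → (∃ C, ∀ σ, |F σ| ≤ C) →
      ∫ σ, avg J Λ F σ ∂μ = ∫ σ, F σ ∂μ) : IsGibbs J μ := by
  refine ⟨inferInstance, fun Λ A => ?_⟩
  have hset : MeasurableSet {σ : V → Fin q | Λ.restrict σ ∈ A} :=
    (measurable_pi_iff.2 fun k => measurable_pi_apply (k : V) :
      Measurable (Λ.restrict (π := fun _ => Fin q))) A.toFinite.measurableSet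
  have hspec : Measurable[outside q Λ] fun σ => (spec J Λ σ).real A := by
    simp only [spec_real hJ (h Λ) (ha Λ)]
    exact Finset.measurable_sum _ fun τ _ =>
      (measurable_outside_prob hJ (h Λ) (ha Λ) τ).mul_const _
  have hspec' := hspec.mono (outside_le Λ) le_rfl
  have hb : ∃ C, ∀ σ, |(spec J Λ σ).real A| ≤ C := ⟨1, fun σ => by
    rw [spec_real hJ (h Λ) (ha Λ)]
    refine abs_sum_prob_mul_le (ha Λ) σ fun τ => ?_
    by_cases hτ : τ ∈ A <;> simp [hτ]⟩
  refine (ae_eq_condExp_of_forall_setIntegral_eq (outside_le Λ)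
    (integrable_of_bounded (measurable_const.indicator hset) (bounded_indicator _))
    (fun s _ _ => (integrable_of_bounded hspec' hb).integrableOn) (fun B hB _ => ?_)
    hspec.stronglyMeasurable.aestronglyMeasurable).symm
  have hB' : MeasurableSet B := outside_le Λ B hB
  rw [← integral_indicator hB', ← integral_indicator hB']
  have h1 := hμ Λ (B.indicator ({σ : V → Fin q | Λ.restrict σ ∈ A}.indicator fun _ => 1))
    ((measurable_const.indicator hset).indicator hB') (by
      rw [Set.indicator_indicator]; exact bounded_indicator _)
  refine Eq.trans (integral_congr_ae (.of_forall fun σ => ?_)) h1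
  have h2 : ∀ τ, patch Λ τ σ ∈ B ↔ σ ∈ B := fun τ =>
    mem_iff_of_measurableSet_outside hB fun k hk => patch_of_notMem _ _ hk
  have h3 : ∀ τ, {σ : V → Fin q | Λ.restrict σ ∈ A}.indicator (fun _ => (1 : ℝ)) (patch Λ τ σ) =
      A.indicator 1 τ := by
    intro τ
    simp only [Set.indicator, Set.mem_ofPred_eq, restrict_patch, Pi.one_apply]
  by_cases hσ : σ ∈ B
  · simp only [avg, Set.indicator_of_mem hσ, Set.indicator_of_mem ((h2 _).2 hσ), h3]
    exact spec_real hJ (h Λ) (ha Λ) σ A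
  · simp [avg, hσ, h2]

/-- The DLR equations for cylinder events imply those for all bounded observables. -/
lemma integral_avg_of_cylinder (hJ : ∀ e, J e ≤ 0) {Λ : Finset V} (h : (touching J Λ).Finite)
    (ha : Admissible q J Λ) {μ : Measure (V → Fin q)} [IsProbabilityMeasure μ]
    (hμ : ∀ C ∈ measurableCylinders fun _ : V => Fin q,
      ∫ σ, avg J Λ (C.indicator 1) σ ∂μ = ∫ σ, C.indicator (1 : (V → Fin q) → ℝ) σ ∂μ)
    {F : (V → Fin q) → ℝ} (hF : Measurable F) (hb : ∃ C, ∀ σ, |F σ| ≤ C) :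
    ∫ σ, avg J Λ F σ ∂μ = ∫ σ, F σ ∂μ := by
  have hpm : ∀ τ : Λ → Fin q, Measurable fun σ => prob J Λ σ τ := measurable_prob hJ h ha
  have hpb : ∀ τ : Λ → Fin q, ∃ C, ∀ σ, |prob J Λ σ τ| ≤ C := fun τ => ⟨1, fun σ => by
    rw [abs_of_nonneg (prob_nonneg _ _ _), ← sum_prob ha σ]
    exact Finset.single_le_sum (fun η _ => prob_nonneg Λ σ η) (Finset.mem_univ τ)⟩
  -- The sum of these measures is the law of a `μ`-configuration after resampling `Λ`; it equals `μ`
  -- as soon as the two agree on cylinders.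
  set ν₀ : (Λ → Fin q) → Measure (V → Fin q) := fun τ =>
    (μ.withDensity fun σ => ENNReal.ofReal (prob J Λ σ τ)).map fun σ => patch Λ τ σ
  have hfin : ∀ τ, IsFiniteMeasure (μ.withDensity fun σ => ENNReal.ofReal (prob J Λ σ τ)) :=
    fun τ => isFiniteMeasure_withDensity_ofReal (integrable_of_bounded (hpm τ) (hpb τ)).2
  have hfin' : ∀ τ, IsFiniteMeasure (ν₀ τ) := fun τ => inferInstance
  have key : ∀ G : (V → Fin q) → ℝ, Measurable G → (∃ C, ∀ σ, |G σ| ≤ C) →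
      ∫ σ, G σ ∂(∑ τ, ν₀ τ) = ∫ σ, avg J Λ G σ ∂μ := by
    intro G hG hGb
    rw [integral_finsetSum_measure fun τ _ => integrable_of_bounded hG hGb]
    have hint : ∀ τ : Λ → Fin q, Integrable (fun σ => prob J Λ σ τ * G (patch Λ τ σ)) μ :=
      fun τ => integrable_mul_of_bounded (hpm τ) (hpb τ)
        (hG.comp (measurable_patch Λ τ)) (let ⟨C, hC⟩ := hGb; ⟨C, fun σ => hC _⟩)
    unfold avg
    rw [integral_finsetSum _ fun τ _ => hint τ]
    refine Finset.sum_congr rfl fun τ _ => ?_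
    rw [integral_map (measurable_patch Λ τ).aemeasurable hG.aestronglyMeasurable,
      integral_withDensity_eq_integral_toReal_smul (hpm τ).ennreal_ofReal
        (.of_forall fun _ => ENNReal.ofReal_lt_top)]
    refine integral_congr_ae (.of_forall fun σ => ?_)
    simp only [smul_eq_mul, ENNReal.toReal_ofReal (prob_nonneg Λ σ τ)]
  have heq : μ = ∑ τ, ν₀ τ := by
    refine ext_of_cylinder_integral fun C hC => ?_
    rw [key _ (measurable_one.indicator (MeasurableSet.of_mem_measurableCylinders hC))
      (bounded_indicator C), hμ C hC]
  rw [← key F hF hb, ← heq]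

end DLR

/-! ### Finite-volume Gibbs distributions -/

section FiniteVolume

variable {J : Sym2 V → EReal}

/-- The finite-volume Gibbs distribution with external condition `σ`. -/
def finiteGibbs (J : Sym2 V → EReal) (Λ : Finset V) (σ : V → Fin q) : Measure (V → Fin q) :=
  ∑ τ : Λ → Fin q, ENNReal.ofReal (prob J Λ σ τ) • Measure.dirac (patch Λ τ σ)

lemma isProbabilityMeasure_finiteGibbs {Λ : Finset V} (ha : Admissible q J Λ) (σ : V → Fin q) :
    IsProbabilityMeasure (finiteGibbs J Λ σ) := by
  constructor
  simp only [finiteGibbs, Measure.finsetSum_apply, Measure.smul_apply, measure_univ, smul_eq_mul,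
    mul_one]
  rw [← ENNReal.ofReal_sum_of_nonneg fun τ _ => prob_nonneg Λ σ τ, sum_prob ha,
    ENNReal.ofReal_one]

end FiniteVolume

/-! ### Existence by compactness -/

section Existence

variable [Countable V] {J : Sym2 V → EReal}

lemma integral_finiteGibbs {Λ : Finset V} {σ : V → Fin q} {f : (V → Fin q) → ℝ}
    (hf : Measurable f) (hb : ∃ C, ∀ σ, |f σ| ≤ C) :
    ∫ x, f x ∂(finiteGibbs J Λ σ) = avg J Λ f σ := by
  rw [finiteGibbs, integral_finsetSum_measure fun τ _ =>
    (integrable_of_bounded hf hb).smul_measure ENNReal.ofReal_ne_top]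
  refine Finset.sum_congr rfl fun τ _ => ?_
  rw [integral_smul_measure, integral_dirac, smul_eq_mul,
    ENNReal.toReal_ofReal (prob_nonneg Λ σ τ)]

lemma exists_isGibbs (hJ : ∀ e, J e ≤ 0) (h : ∀ Λ, (touching J Λ).Finite)
    (ha : ∀ Λ, Admissible q J Λ) [Nonempty (V → Fin q)] :
    ∃ μ : Measure (V → Fin q), IsGibbs J μ := by
  obtain ⟨σ₀⟩ := ‹Nonempty (V → Fin q)›
  set ν : Finset V → ProbabilityMeasure (V → Fin q) := fun Λ =>
    ⟨finiteGibbs J Λ σ₀, isProbabilityMeasure_finiteGibbs (ha Λ) σ₀⟩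
  -- An ultrafilter finer than `atTop` converges by compactness and still eventually contains every
  -- fixed volume.
  set U : Ultrafilter (Finset V) := Ultrafilter.of Filter.atTop
  obtain ⟨μ, -, hμ⟩ := (isCompact_univ (X := ProbabilityMeasure (V → Fin q))).ultrafilter_le_nhds
    (U.map ν) (by simp)
  have hlim : Filter.Tendsto ν U (nhds μ) := hμ
  rw [ProbabilityMeasure.tendsto_iff_forall_integral_tendsto] at hlim
  have hlim' : ∀ f : (V → Fin q) → ℝ, Continuous f → (∃ C, ∀ σ, |f σ| ≤ C) →
      Filter.Tendsto (fun Λ => avg J Λ f σ₀) U (nhds (∫ σ, f σ ∂(μ : Measure (V → Fin q)))) := by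
    intro f hf hb
    obtain ⟨C, hC⟩ := hb
    refine (hlim (BoundedContinuousFunction.ofNormedAddCommGroup f hf C hC)).congr fun Λ => ?_
    exact integral_finiteGibbs hf.measurable ⟨C, hC⟩
  refine ⟨μ, isGibbs_of_integral_avg hJ h ha fun Λ F hF hFb =>
    integral_avg_of_cylinder hJ (h Λ) (ha Λ) (fun C hC => ?_) hF hFb⟩
  have hcont := (continuous_and_totalOsc_cylinder_indicator hC).1
  have hb := bounded_indicator C
  -- By consistency a cylinder function and its average over `Λ` have the same finite-volume
  -- expectations in all `Λ' ⊇ Λ`; both are continuous, so their limits agree.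
  refine tendsto_nhds_unique (hlim' _ (continuous_avg hJ (h Λ) (ha Λ) hcont)
    (bounded_avg (ha Λ) hb)) ((hlim' _ hcont hb).congr' ?_)
  have h1 : ∀ᶠ Λ' in (Filter.atTop : Filter (Finset V)), Λ ⊆ Λ' := Filter.eventually_ge_atTop Λ
  filter_upwards [(Ultrafilter.of_le Filter.atTop) h1] with Λ' hΛ'
  rw [avg_avg hJ hΛ' (h Λ') (ha Λ)]

end Existence

/-! ### Zero-one law and observables of finite total oscillation -/

section Triviality

variable [Countable V] {J : Sym2 V → EReal} {r : ℕ}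

/-- The indicator of `A` has zero oscillation everywhere, so the covariance bound makes `A`
independent of every cylinder event, hence of itself. -/
lemma Invariant.measure_eq_zero_or_one {μ : Measure (V → Fin q)} [IsProbabilityMeasure μ]
    (hμ : Invariant J μ) (hJ : ∀ e, J e ≤ 0) (hq : 2 * r < q)
    (h : ∀ i : V, ((nnGraph J).neighborSet i).encard ≤ r)
    {A : Set (V → Fin q)} (hA : MeasurableSet A)
    (hflip : ∀ (i : V) (σ σ' : V → Fin q), (∀ k, k ≠ i → σ k = σ' k) → (σ ∈ A ↔ σ' ∈ A)) :
    μ A = 0 ∨ μ A = 1 := by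
  have hosc : ∀ i, osc (A.indicator (1 : (V → Fin q) → ℝ)) i = 0 := fun i => by
    refine le_antisymm (osc_le fun σ σ' hσ => ?_) zero_le
    by_cases hσA : σ' ∈ A
    · simp [hσA, (hflip i σ σ' hσ).2 hσA]
    · simp [hσA, mt (hflip i σ σ' hσ).1 hσA]
  have hcyl : ∀ C ∈ measurableCylinders fun _ : V => Fin q,
      (μ.restrict A) C = (μ A • μ) C := by
    intro C hC
    have hCm : MeasurableSet C := MeasurableSet.of_mem_measurableCylinders hC
    obtain ⟨hcont, hfin⟩ := continuous_and_totalOsc_cylinder_indicator hC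
    have h1 := cov_le_of_continuous hJ hq h hμ hcont (bounded_indicator C) hfin
      (measurable_one.indicator hA) (bounded_indicator A)
    simp only [hosc, mul_zero, tsum_zero, nonpos_iff_eq_zero, ENNReal.ofReal_eq_zero] at h1
    have h2 := sub_eq_zero.1 (abs_nonpos_iff.1 h1)
    have h3 : (fun σ => C.indicator (1 : (V → Fin q) → ℝ) σ * A.indicator 1 σ) =
        (C ∩ A).indicator 1 := by
      funext σ
      rw [Set.inter_indicator_one]
      rfl
    rw [h3, integral_indicator_one (hCm.inter hA), integral_indicator_one hCm,
      integral_indicator_one hA] at h2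
    rw [Measure.restrict_apply hCm, Measure.smul_apply, smul_eq_mul, mul_comm,
      ← ENNReal.toReal_eq_toReal_iff' (measure_ne_top _ _)
        (ENNReal.mul_ne_top (measure_ne_top _ _) (measure_ne_top _ _)), ENNReal.toReal_mul]
    exact h2
  have heq : μ.restrict A = μ A • μ :=
    ext_of_generate_finite _ generateFrom_measurableCylinders.symm
      isPiSystem_measurableCylinders hcyl (hcyl _ (univ_mem_measurableCylinders _))
  have h1 : μ A = μ A * μ A := by
    have := congrArg (fun ν => ν A) heq
    simpa using this
  rcases eq_or_ne (μ A) 0 with h0 | h0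
  · exact Or.inl h0
  · refine Or.inr ?_
    have := (ENNReal.mul_right_inj h0 (measure_ne_top μ A)).1 (h1.symm.trans (mul_one _).symm)
    exact this

lemma Invariant.exists_ae_abs_sub_le {μ : Measure (V → Fin q)} [IsProbabilityMeasure μ]
    (hμ : Invariant J μ) (hJ : ∀ e, J e ≤ 0) (hq : 2 * r < q)
    (h : ∀ i : V, ((nnGraph J).neighborSet i).encard ≤ r)
    {f : (V → Fin q) → ℝ} (hf : Measurable f) (hosc : totalOsc f ≠ ∞) :
    ∃ c, ∀ᵐ σ ∂μ, |f σ - c| ≤ (totalOsc f).toReal := by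
  -- The supremum over all finite modifications is unaffected by single-site changes, so the
  -- zero-one law makes it almost surely constant; it lies between `f` and `f` plus the total
  -- oscillation.
  set F : (V → Fin q) → ℝ := fun σ => ⨆ p : (Σ Λ : Finset V, (Λ → Fin q)), f (patch p.1 p.2 σ)
    with hF
  have hFm : Measurable F := Measurable.iSup fun p => hf.comp (measurable_patch p.1 p.2)
  have hbd : ∀ σ (p : Σ Λ : Finset V, (Λ → Fin q)),
      f (patch p.1 p.2 σ) ≤ f σ + (totalOsc f).toReal := by
    intro σ p
    have h1 := (ENNReal.ofReal_le_iff_le_toReal hosc).1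
      (ofReal_abs_sub_le_totalOsc_of_finset f p.1 (σ := patch p.1 p.2 σ) (σ' := σ)
        fun k hk => patch_of_notMem _ _ hk)
    linarith [(abs_le.1 h1).2]
  have hbdd : ∀ σ, BddAbove (Set.range fun p : (Σ Λ : Finset V, (Λ → Fin q)) =>
      f (patch p.1 p.2 σ)) := fun σ => ⟨_, by rintro _ ⟨p, rfl⟩; exact hbd σ p⟩
  have hne : Nonempty (Σ Λ : Finset V, (Λ → Fin q)) := ⟨⟨∅, fun _ => ⟨0, by omega⟩⟩⟩
  have hF_le : ∀ σ, F σ ≤ f σ + (totalOsc f).toReal := fun σ => ciSup_le (hbd σ)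
  have hle_F : ∀ σ, f σ ≤ F σ := fun σ => by
    have := le_ciSup (hbdd σ) ⟨∅, (∅ : Finset V).restrict σ⟩
    rwa [patch_restrict] at this
  have hflip_le : ∀ (i : V) (σ σ' : V → Fin q), (∀ k, k ≠ i → σ k = σ' k) → F σ ≤ F σ' := by
    intro i σ σ' hσ
    refine ciSup_le fun p => ?_
    have h1 := le_ciSup (hbdd σ')
      ⟨insert i p.1, (insert i p.1).restrict (patch p.1 p.2 σ)⟩
    rwa [patch_restrict_of_eq fun k hk => by
      rw [Finset.mem_insert, not_or] at hk
      rw [patch_of_notMem _ _ hk.2, hσ k hk.1]] at h1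
  have hflip : ∀ (i : V) (σ σ' : V → Fin q), (∀ k, k ≠ i → σ k = σ' k) → F σ = F σ' :=
    fun i σ σ' hσ => le_antisymm (hflip_le i σ σ' hσ)
      (hflip_le i σ' σ fun k hk => (hσ k hk).symm)
  -- Every measurable preimage under `F` has probability 0 or 1, and countably many measurable sets
  -- separate the reals.
  obtain ⟨c, hc⟩ := Filter.exists_eventuallyEq_const_of_forall_separating (l := ae μ) (f := F)
    MeasurableSet fun U hU => by
      have hm : MeasurableSet (F ⁻¹' U) := hFm hU
      rcases hμ.measure_eq_zero_or_one hJ hq h hm fun i σ σ' hσ => by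
        rw [Set.mem_preimage, Set.mem_preimage, hflip i σ σ' hσ] with h0 | h1
      · exact Or.inr (measure_eq_zero_iff_ae_notMem.1 h0)
      · exact Or.inl ((prob_compl_eq_zero_iff hm).2 h1)
  refine ⟨c, ?_⟩
  filter_upwards [hc] with σ hσ
  have h1 := hF_le σ
  have h2 := hle_F σ
  rw [hσ, Function.const_apply] at h1 h2
  rw [abs_le]
  constructor <;> linarith [ENNReal.toReal_nonneg (a := totalOsc f)]

/-- An observable of finite total oscillation is almost surely equal to a bounded one with
smaller oscillations. -/
lemma Invariant.exists_bounded_ae_eq {μ : Measure (V → Fin q)} [IsProbabilityMeasure μ]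
    (hμ : Invariant J μ) (hJ : ∀ e, J e ≤ 0) (hq : 2 * r < q)
    (h : ∀ i : V, ((nnGraph J).neighborSet i).encard ≤ r)
    {f : (V → Fin q) → ℝ} (hf : Measurable f) (hosc : totalOsc f ≠ ∞) :
    ∃ f' : (V → Fin q) → ℝ, Measurable f' ∧ (∃ C, ∀ σ, |f' σ| ≤ C) ∧ f =ᵐ[μ] f' ∧
      ∀ i, osc f' i ≤ osc f i := by
  obtain ⟨c, hc⟩ := hμ.exists_ae_abs_sub_le hJ hq h hf hosc
  set D := (totalOsc f).toReal
  have hD : 0 ≤ D := ENNReal.toReal_nonneg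
  -- Truncation to `[c - D, c + D]` is 1-Lipschitz, so it does not increase oscillations, and it
  -- alters `f` only on a null set.
  refine ⟨fun σ => max (min (f σ) (c + D)) (c - D), (hf.min measurable_const).max measurable_const,
    ⟨|c| + D, fun σ => ?_⟩, ?_, fun i => osc_le fun σ σ' hσ => ?_⟩
  · rw [abs_le]
    constructor
    · exact le_trans (by linarith [neg_abs_le c]) (le_max_right _ _)
    · exact max_le ((min_le_right _ _).trans (by linarith [le_abs_self c]))
        (by linarith [le_abs_self c])
  · filter_upwards [hc] with σ hσ
    rw [abs_le] at hσ
    rw [min_eq_left (by linarith), max_eq_left (by linarith)]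
  · refine le_trans (ENNReal.ofReal_le_ofReal ?_) (ofReal_abs_sub_le_osc f hσ)
    refine (abs_max_sub_max_le_abs _ _ _).trans ((abs_min_sub_min_le_max _ _ _ _).trans ?_)
    simp

theorem Invariant.hasExpDecay {μ : Measure (V → Fin q)} [IsProbabilityMeasure μ]
    (hμ : Invariant J μ) (hJ : ∀ e, J e ≤ 0) (hq : 2 * r < q)
    (h : ∀ i : V, ((nnGraph J).neighborSet i).encard ≤ r) :
    HasExpDecay (nnGraph J) ((q : ℝ) / (q - 2 * r)) (Real.log (2 * (q - r) / q)) μ := by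
  intro f g hf hg hfo hgo
  obtain ⟨f', hf', hfb, hff', hfosc⟩ := hμ.exists_bounded_ae_eq hJ hq h hf hfo.ne
  obtain ⟨g', hg', hgb, hgg', hgosc⟩ := hμ.exists_bounded_ae_eq hJ hq h hg hgo.ne
  have hfg : (fun σ => f σ * g σ) =ᵐ[μ] fun σ => f' σ * g' σ := hff'.mul hgg'
  refine ⟨(integrable_of_bounded hf' hfb).congr hff'.symm,
    (integrable_of_bounded hg' hgb).congr hgg'.symm,
    (integrable_mul_of_bounded hf' hfb hg' hgb).congr hfg.symm, ?_⟩
  rw [integral_congr_ae hfg, integral_congr_ae hff', integral_congr_ae hgg']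
  have hfo' : totalOsc f' ≠ ∞ := ne_top_of_le_ne_top hfo.ne (ENNReal.tsum_le_tsum hfosc)
  refine (cov_le_of_close hJ hq h hμ hf' hfb hfo' hg' hgb fun l hl =>
    hμ.exists_ae_abs_sub_le hJ hq h (measurable_sweep hJ (by omega) h l hf') hl).trans ?_
  gcongr with i j
  · exact hfosc i
  · exact hgosc j

end Triviality

/-! ### Uniqueness of the Gibbs measure and the bound on the Dobrushin constant -/

section Main

variable [Countable V] {J : Sym2 V → EReal} {r : ℕ}

lemma IsGibbs.invariant {μ : Measure (V → Fin q)} (hμ : IsGibbs J μ) (hJ : ∀ e, J e ≤ 0)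
    (hqr : r < q) (h : ∀ i : V, ((nnGraph J).neighborSet i).encard ≤ r) : Invariant J μ :=
  fun i _ hF hb => hμ.integral_avg hJ (touching_finite_of_encard_le h {i})
    (admissible_singleton hJ hqr (h i)) hF hb

theorem existsUnique_isGibbs (hJ : ∀ e, J e ≤ 0) (hq : 2 * r < q)
    (h : ∀ i : V, ((nnGraph J).neighborSet i).encard ≤ r) :
    ∃! μ : Measure (V → Fin q), IsGibbs J μ := by
  have hqr : r < q := by omega
  have hne : Nonempty (V → Fin q) := ⟨fun _ => ⟨0, by omega⟩⟩
  obtain ⟨μ, hμ⟩ := exists_isGibbs hJ (touching_finite_of_encard_le h)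
    (admissible_of_encard_le hJ hqr h)
  refine ⟨μ, hμ, fun ν hν => ?_⟩
  have := hμ.isProbabilityMeasure
  have := hν.isProbabilityMeasure
  exact invariant_unique hJ hq h (hν.invariant hJ hqr h) (hμ.invariant hJ hqr h)

end Main

theorem dobrushinConst_le {J : Sym2 V → EReal} {r : ℕ} (hJ : ∀ e, J e ≤ 0) (hqr : r < q)
    (h : ∀ i : V, ((nnGraph J).neighborSet i).encard ≤ r) :
    dobrushinConst q J ≤ ENNReal.ofReal ((r : ℝ) / ((q : ℝ) - r)) :=
  iSup_le fun i => tsum_dobrushinCoeff_le hJ hqr (h i)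

end

end Potts

theorem mainTheorem1 (q r : ℕ) (hqr : r < q) :
    (∀ (V : Type*) [Countable V] (J : Sym2 V → EReal), (∀ e, J e ≤ 0) →
      (∀ i : V, ((Potts.nnGraph J).neighborSet i).encard ≤ r →
        (∀ j : V, j ≠ i →
          Potts.dobrushinCoeff q J i j ≤ ENNReal.ofReal (1 / ((q : ℝ) - r))) ∧
        ∑' j : {j : V // j ≠ i}, Potts.dobrushinCoeff q J i j ≤
          ENNReal.ofReal ((r : ℝ) / ((q : ℝ) - r))) ∧
      ((∀ i : V, ((Potts.nnGraph J).neighborSet i).encard ≤ r) →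
        Potts.dobrushinConst q J ≤ ENNReal.ofReal ((r : ℝ) / ((q : ℝ) - r)))) ∧
    (2 * r < q →
      ∃ K m : ℝ, 0 < m ∧
        ∀ (V : Type*) [Countable V] (J : Sym2 V → EReal), (∀ e, J e ≤ 0) →
          (∀ i : V, ((Potts.nnGraph J).neighborSet i).encard ≤ r) →
          Potts.dobrushinConst q J < 1 ∧
          (∃! μ : Measure (V → Fin q), Potts.IsGibbs J μ) ∧
          ∀ μ : Measure (V → Fin q), Potts.IsGibbs J μ →
            Potts.HasExpDecay (Potts.nnGraph J) K m μ) := by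
  refine ⟨fun V _ J hJ => ⟨fun i hi => ⟨fun j _ => Potts.dobrushinCoeff_le hJ hqr hi j,
    Potts.tsum_dobrushinCoeff_le hJ hqr hi⟩, Potts.dobrushinConst_le hJ hqr⟩, fun hq => ?_⟩
  have hq' : 2 * (r : ℝ) < q := by exact_mod_cast hq
  have hr : (0 : ℝ) ≤ r := Nat.cast_nonneg r
  have hq0 : (0 : ℝ) < q := by linarith
  refine ⟨(q : ℝ) / (q - 2 * r), Real.log (2 * (q - r) / q), Real.log_pos ?_,
    fun V _ J hJ h => ⟨?_, Potts.existsUnique_isGibbs hJ hq h, fun μ hμ => ?_⟩⟩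
  · rw [one_lt_div hq0]
    linarith
  · refine (Potts.dobrushinConst_le hJ hqr h).trans_lt ?_
    rw [ENNReal.ofReal_lt_one, div_lt_one (by linarith)]
    linarith
  · have := hμ.isProbabilityMeasure
    exact (hμ.invariant hJ hqr h).hasExpDecay hJ hq h
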